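/- **Setting.** For matrices of equal size let $\langle A,B\rangle=\sum_{ij}A_{ij}B_{ij}$, $\|A\|_F^2=\langle A,A\rangle$ and $\mathbf D_2(A,B)=\|A-B\|_F^2/2$; for a differentiable $\psi$ let $\mathbf\Delta_\psi(\alpha,\beta)=\psi(\alpha)-\psi(\beta)-\langle\nabla\psi(\beta),\alpha-\beta\rangle$. Let $X\in\mathbb R^{n\times p}$ be a fixed design matrix, $\sigma>0$, and $\nu$ a nonzero measure on $\mathbb R^{n\times m}$. Put $\Omega=\{\eta\in\mathbb R^{n\times m}:\int e^{\langle y,\eta\rangle/\sigma^2}d\nu(y)<\infty\}$ and $b_\nu(\eta)=\sigma^2\log\int e^{\langle y,\eta\rangle/\sigma^2}d\nu(y)$ for $\eta\in\Omega$. For $\eta\in\Omega$ let $P_\eta$ have density $\exp\{(\langle y,\eta\rangle-b_\nu(\eta))/\sigma^2\}$ with respect to $\nu$, and let $l_0(\eta;Y)=\{-\langle Y,\eta\rangle+b_\nu(\eta)\}/\sigma^2$ (note that $\mathbf\Delta_{l_0}$ does not depend on $Y$). Assume the family is regular, i.e. $\Omega$ is open. Let $$\mathcal S(q,r)=\{B\in\mathbb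 R^{p\times m}: B\text{ has at most }q\text{ distinct rows},\ \mathrm{rank}(B)\le r\},$$ where $p\ge q\ge r\ge 2$, $m\ge r$ and $r(q\wedge\mathrm{rank}(X)+m-r)\ge4$; assume $XB\in\Omega$ for all $B\in\mathcal S(q,r)$. One observes $Y\sim P_{XB^*}$ with $B^*\in\mathcal S(q,r)$; $\mathbb E$ is expectation under this law, and $\inf_{\hat B}$ is over all estimators (measurable functions $\hat B=\hat B(Y)\in\mathbb R^{p\times m}$). Call a pair of integers $(b,\zeta)$ admissible if $b\ge2$, $1\le\zeta\le r$ and $\sum_{i=0}^{\zeta}\binom ri(b-1)^i\ge q$. Put $$P(q,r)=(q+m)r+p\{\log(er)-\log\log q\}.$$ Let $I:[0,\infty)\to\mathbb R$ be nondecreasing with $I(0)=0$, $I\not\equiv0$. **Theorem.** There are constants $c,c'>0$ depending only on $I$ such that, for all $n,p,m,q,r,\sigma,\nu,X$ as above, the following hold. (a) *Estimation.* Suppose $\kappa>0$ and $\mathbf\Delta_{l_0}(0,XB)\,\sigma^2\le\kappa\|B\|_F^2/2$ for all $B\in\mathcal S(q,r)$. Then for every admissible $(b,\zeta)$ $$\inf_{\hat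 B}\sup_{B^*\in\mathcal S(q,r)}\mathbb E\,I\Big(\|B^*-\hat B\|_F^2\Big/\Big[c\,\sigma^2\Big\{(q+m)r+\frac{p\log q}{b^2\zeta}\Big\}/\kappa\Big]\Big)\ge c',$$ and, if $8\le q\le e^r$, $$\inf_{\hat B}\sup_{B^*\in\mathcal S(q,r)}\mathbb E\,I\big(\|B^*-\hat B\|_F^2/\{c\,\sigma^2P(q,r)/\kappa\}\big)\ge c'.$$ (b) *Prediction.* Let $\underline\kappa,\overline\kappa>0$. (b1) Suppose $q\le\mathrm{rank}(X)$ and, for all $B_1,B_2\in\mathcal S(q,r)$, $\underline\kappa\,\mathbf D_2(B_1,B_2)\le\mathbf D_2(XB_1,XB_2)$ and $\mathbf\Delta_{l_0}(0,XB_1)\sigma^2\le\overline\kappa\,\mathbf D_2(0,B_1)$. Then for every admissible $(b,\zeta)$ $$\inf_{\hat B}\sup_{B^*\in\mathcal S(q,r)}\mathbb E\,I\Big(\|XB^*-X\hat B\|_F^2\Big/\Big[c\,\frac{\underline\kappa}{\overline\kappa}\,\sigma^2\Big\{(q+m)r+\frac{p\log q}{b^2\zeta}\Big\}\Big]\Big)\ge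 c'.$$ (b2) Suppose $r\le\mathrm{rank}(X)<q$, let $X=UDV^T$ be a compact singular value decomposition ($U,V$ with $\mathrm{rank}(X)$ orthonormal columns, $D$ diagonal with positive diagonal entries), $Z=UD$, and suppose that, for all $C_1,C_2\in\mathbb R^{\mathrm{rank}(X)\times m}$ of rank at most $r$, $\underline\kappa\,\mathbf D_2(C_1,C_2)\le\mathbf D_2(ZC_1,ZC_2)$ and $\mathbf\Delta_{l_0}(0,ZC_1)\sigma^2\le\overline\kappa\,\mathbf D_2(0,C_1)$. Then $$\inf_{\hat B}\sup_{B^*\in\mathcal S(q,r)}\mathbb E\,I\Big(\|XB^*-X\hat B\|_F^2\Big/\Big[c\,\frac{\underline\kappa}{\overline\kappa}\,\sigma^2(\mathrm{rank}(X)+m)r\Big]\Big)\ge c'.$$ (b3) Moreover there is a universal constant $c_0>0$ such that, in the situation of (b1) with in addition $8\le q\le e^r$, $$\inf_{\hat B}\sup_{B^*\in\mathcal S(q,r)}\mathbb E\|XB^*-X\hat B\|_F^2\ge c_0\,\frac{\underline\kappa}{\overline\kappa}\,\sigma^2P(q,r).$$ -/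

import Mathlib

open MeasureTheory
open scoped ENNReal

noncomputable section

namespace CRL

variable {n p m : ℕ}

/-- The trace inner product `⟨A, B⟩ = ∑ᵢⱼ Aᵢⱼ Bᵢⱼ`. -/
def frobInner (A B : Matrix (Fin n) (Fin m) ℝ) : ℝ :=
  ∑ i, ∑ j, A i j * B i j

/-- The squared Frobenius norm `‖A‖_F²`. -/
def frobSq (A : Matrix (Fin n) (Fin m) ℝ) : ℝ :=
  ∑ i, ∑ j, A i j ^ 2

/-- `D₂(A, B) = ‖A - B‖_F² / 2`. -/
def D₂ (A B : Matrix (Fin n) (Fin m) ℝ) : ℝ :=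
  frobSq (A - B) / 2

/-- The generalized Bregman function
`Δ_ψ(α, β) = ψ(α) - ψ(β) - ⟨∇ψ(β), α - β⟩`; the last term is the Fréchet derivative of `ψ` at `β`
in the direction `α - β`. -/
def bregman (ψ : Matrix (Fin n) (Fin m) ℝ → ℝ) (α β : Matrix (Fin n) (Fin m) ℝ) : ℝ :=
  ψ α - ψ β - fderiv ℝ ψ β (α - β)

/-- The number of distinct rows of `B`. -/
def numDistinctRows (B : Matrix (Fin p) (Fin m) ℝ) : ℕ :=
  (Set.range fun i : Fin p => B.row i).ncard

/-- The signal class `S(q, r)`. -/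
def signalClass (p m q r : ℕ) : Set (Matrix (Fin p) (Fin m) ℝ) :=
  {B | numDistinctRows B ≤ q ∧ B.rank ≤ r}

/-- Matrices carry the product (equivalently Borel) `σ`-algebra of their entries. -/
instance instMeasurableSpaceMatrix : MeasurableSpace (Matrix (Fin n) (Fin m) ℝ) :=
  inferInstanceAs (MeasurableSpace (Fin n → Fin m → ℝ))

/-- The natural parameter space `Ω = {η : ∫ exp(⟨y, η⟩ / σ²) dν(y) < ∞}` of the exponential
dispersion family with base measure `ν` and dispersion `σ²`. -/
def naturalSpace (ν : Measure (Matrix (Fin n) (Fin m) ℝ)) (σ : ℝ) :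
    Set (Matrix (Fin n) (Fin m) ℝ) :=
  {η | Integrable (fun y => Real.exp (frobInner y η / σ ^ 2)) ν}

/-- The cumulant function `b(η) = σ² log ∫ exp(⟨y, η⟩ / σ²) dν(y)`, i.e. the function which makes
`exp((⟨y, η⟩ - b(η)) / σ²)` a probability density with respect to `ν`. -/
def cumulant (ν : Measure (Matrix (Fin n) (Fin m) ℝ)) (σ : ℝ) (η : Matrix (Fin n) (Fin m) ℝ) : ℝ :=
  σ ^ 2 * Real.log (∫ y, Real.exp (frobInner y η / σ ^ 2) ∂ν)

/-- The law of `Y` with systematic component `η`: density `exp((⟨y, η⟩ - b(η)) / σ²)` with respect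
to the base measure `ν`. -/
def glmLaw (ν : Measure (Matrix (Fin n) (Fin m) ℝ)) (σ : ℝ) (η : Matrix (Fin n) (Fin m) ℝ) :
    Measure (Matrix (Fin n) (Fin m) ℝ) :=
  ν.withDensity fun y =>
    ENNReal.ofReal (Real.exp ((frobInner y η - cumulant ν σ η) / σ ^ 2))

/-- The scaled negative log-likelihood `l₀(η; Y) = (-⟨Y, η⟩ + b(η)) / σ²`. -/
def glmLoss (ν : Measure (Matrix (Fin n) (Fin m) ℝ)) (σ : ℝ) (Y η : Matrix (Fin n) (Fin m) ℝ) : ℝ :=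
  (-frobInner Y η + cumulant ν σ η) / σ ^ 2

/-- The standing model: for every coefficient matrix of the signal class, `Y` given `X B` follows
the exponential family with base measure `ν` and dispersion `σ²`; the family is regular (its
natural parameter space is open), and the dimensions satisfy the standing restrictions. -/
structure IsModel (q r : ℕ) (σ : ℝ) (ν : Measure (Matrix (Fin n) (Fin m) ℝ))
    (X : Matrix (Fin n) (Fin p) ℝ) : Prop where
  two_le_r : 2 ≤ r
  r_le_q : r ≤ q
  q_le_p : q ≤ p
  r_le_m : r ≤ m
  dim : 4 ≤ r * (min q X.rank + m - r)
  σ_pos : 0 < σ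
  ν_ne_zero : ν ≠ 0
  regular : IsOpen (naturalSpace ν σ)
  mem_naturalSpace : ∀ B ∈ signalClass p m q r, X * B ∈ naturalSpace ν σ

/-- The admissible pairs of integers: `b ≥ 2`, `1 ≤ ζ ≤ r` and `∑_{i ≤ ζ} C(r, i) (b - 1)^i ≥ q`. -/
def Admissible (q r b ζ : ℕ) : Prop :=
  2 ≤ b ∧ 1 ≤ ζ ∧ ζ ≤ r ∧ q ≤ ∑ i ∈ Finset.range (ζ + 1), r.choose i * (b - 1) ^ i

/-- The general rate `(q + m) r + p log q / (b² ζ)`. -/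
def generalRate (p m q r b ζ : ℕ) : ℝ :=
  ((q : ℝ) + m) * r + p * Real.log q / ((b : ℝ) ^ 2 * ζ)

/-- The complexity function `P(q, r) = (q + m) r + p {log(e r) - log log q}`. -/
def complexityP (p m q r : ℕ) : ℝ :=
  ((q : ℝ) + m) * r + p * (Real.log (Real.exp 1 * r) - Real.log (Real.log q))

/-- A compact singular value decomposition `X = U D Vᵀ`: `U` and `V` have `rank X` orthonormal
columns and `D = diag(d)` with positive entries. -/
structure IsCompactSVD (X : Matrix (Fin n) (Fin p) ℝ) (U : Matrix (Fin n) (Fin X.rank) ℝ)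
    (d : Fin X.rank → ℝ) (V : Matrix (Fin p) (Fin X.rank) ℝ) : Prop where
  U_orth : U.transpose * U = 1
  V_orth : V.transpose * V = 1
  d_pos : ∀ i, 0 < d i
  eq : X = U * Matrix.diagonal d * V.transpose

/-- An arbitrary loss function `I : [0, ∞) → ℝ`: nondecreasing, `I(0) = 0` and `I ≢ 0`
(values of `I` at negative arguments play no role). -/
structure IsLossFunction (I : ℝ → ℝ) : Prop where
  mono : MonotoneOn I (Set.Ici 0)
  zero : I 0 = 0
  nontrivial : ∃ t, 0 ≤ t ∧ I t ≠ 0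

/-- The minimax risk `inf_{B̂} sup_{B ∈ S(q, r)} E_B [ℓ(B, B̂(Y))]`, where the infimum is over all
estimators, i.e. measurable functions of the data `Y`, and `Y` has law `P_{XB}`. -/
def minimaxRisk (q r : ℕ) (σ : ℝ) (ν : Measure (Matrix (Fin n) (Fin m) ℝ))
    (X : Matrix (Fin n) (Fin p) ℝ)
    (ℓ : Matrix (Fin p) (Fin m) ℝ → Matrix (Fin p) (Fin m) ℝ → ℝ) : ℝ≥0∞ :=
  ⨅ (Bhat : Matrix (Fin n) (Fin m) ℝ → Matrix (Fin p) (Fin m) ℝ) (_ : Measurable Bhat),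
    ⨆ B ∈ signalClass p m q r, ∫⁻ Y, ENNReal.ofReal (ℓ B (Bhat Y)) ∂(glmLaw ν σ (X * B))

/-- The restricted curvature condition `Δ_{l₀}(0, X B) σ² ≤ κ D₂(0, B)` on a class of matrices
(`Δ_{l₀(·; Y)}` does not depend on `Y`). -/
def CurvatureBound {k : ℕ} (σ : ℝ) (ν : Measure (Matrix (Fin n) (Fin m) ℝ))
    (X : Matrix (Fin n) (Fin k) ℝ) (S : Set (Matrix (Fin k) (Fin m) ℝ)) (κ : ℝ) : Prop :=
  ∀ B ∈ S, ∀ Y, bregman (glmLoss ν σ Y) 0 (X * B) * σ ^ 2 ≤ κ * D₂ 0 B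

/-- The restricted condition-number condition on a class of matrices, with constants `κlo`, `κhi`. -/
structure CondNumberBound {k : ℕ} (σ : ℝ) (ν : Measure (Matrix (Fin n) (Fin m) ℝ))
    (X : Matrix (Fin n) (Fin k) ℝ) (S : Set (Matrix (Fin k) (Fin m) ℝ)) (κlo κhi : ℝ) : Prop where
  lo_pos : 0 < κlo
  hi_pos : 0 < κhi
  lower : ∀ B₁ ∈ S, ∀ B₂ ∈ S, κlo * D₂ B₁ B₂ ≤ D₂ (X * B₁) (X * B₂)
  upper : CurvatureBound σ ν X S κhi

end CRL

end

/-
An exponential family `P_η` satisfies `KL(P_η, P_0) = Δ_{l₀}(0, η)`, so the upper curvature bound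
makes all hypotheses `P_{XB}` with `‖B‖²` of order `(σ² / κ) log M` hard to tell apart from `P_0`.
If the signal class contains `M` such matrices whose pairwise squared distances are at least
`(σ² / κ) τ`, up to constants, a Fano argument with `P_0` as the common reference bounds the minimax
risk below by a multiple of `I(σ² τ / κ)`; for prediction the lower curvature bound converts
distances of coefficients into distances of predictors.

The packings come from Gilbert–Varshamov codes. Blocks with entries in `{0, c}` of shape
`(q - 1) × r` and `(r - 1) × m` account for `(q + m) r`. For `p log q / (b² ζ)`, fix `q` distinct
words of length `r` over `{0, …, b - 1}` with at most `ζ` nonzero letters, which exist when `(b, ζ)`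
is admissible, and let a code of length `p` over an alphabet of size `q` decide which word each row
repeats. The complexity `P(q, r)` is, up to a constant, the general rate of the admissible pair with
`b = 10` and `ζ = ⌈log q / (log (e r) - log log q)⌉`.

When `rank X < q`, choose `W` with at most `rank X` nonzero rows and `Vᵀ W = 1`. Then `X W = U D`
and `C ↦ W C` sends the matrices of rank at most `r` into the signal class, so packing the former
suffices.
-/

namespace CRL

open Filter InformationTheory Topology
open scoped Finset Matrix Polynomial

variable {n p m : ℕ}

section InformationTheory

variable {Ω : Type*} [MeasurableSpace Ω]

/- Donsker–Varadhan: `klDiv μ ν ≥ ∫ f dμ - log ∫ exp f dν`, applied to `f = t 1_A`. -/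
theorem mul_measureReal_le_klDiv_add_log {μ ν : Measure Ω} [IsProbabilityMeasure μ]
    [IsProbabilityMeasure ν] (hμν : klDiv μ ν ≠ ∞) {A : Set Ω} (hA : MeasurableSet A) (t : ℝ) :
    t * μ.real A ≤ (klDiv μ ν).toReal + Real.log (1 + (Real.exp t - 1) * ν.real A) := by
  obtain ⟨hac, hint⟩ := klDiv_ne_top_iff.1 hμν
  set f : Ω → ℝ := A.indicator fun _ => t
  have hfμ : Integrable f μ := (integrable_const t).indicator hA
  have hexp : (fun ω => Real.exp (f ω)) = fun ω => 1 + A.indicator (fun _ => Real.exp t - 1) ω := by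
    ext ω
    by_cases hω : ω ∈ A <;> simp [f, hω]
  have hfν : Integrable (fun ω => Real.exp (f ω)) ν := by
    rw [hexp]
    exact (integrable_const 1).add ((integrable_const _).indicator hA)
  have hZ : ∫ ω, Real.exp (f ω) ∂ν = 1 + (Real.exp t - 1) * ν.real A := by
    rw [hexp, integral_add (integrable_const 1) ((integrable_const _).indicator hA),
      integral_const, integral_indicator_const _ hA, probReal_univ, smul_eq_mul, smul_eq_mul,
      mul_one, mul_comm]
  have := isProbabilityMeasure_tilted hfν
  have hnonneg : 0 ≤ ∫ ω, llr μ (ν.tilted f) ω ∂μ := by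
    have h := integral_llr_add_sub_measure_univ_nonneg
      (hac.trans (absolutelyContinuous_tilted hfν)) (integrable_llr_tilted_right hac hfμ hint hfν)
    simpa using h
  rw [integral_llr_tilted_right hac hfμ hfν hint, hZ, integral_indicator_const _ hA,
    ← toReal_klDiv_of_measure_eq hac (by simp), smul_eq_mul] at hnonneg
  linarith [mul_comm t (μ.real A)]

theorem eight_mul_log_two_sub_inv_le {M : ℝ} (hM : 2 ≤ M) :
    8 * Real.log (2 - 1 / M) ≤ 6 * Real.log M := by
  have hpos : 0 < 2 - 1 / M := by
    have : 1 / M ≤ 1 := (div_le_one (by linarith)).2 (by linarith)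
    linarith
  have hpow : (2 - 1 / M) ^ 4 ≤ M ^ 3 := by
    have hx : 2 - 1 / M = (2 * M - 1) / M := by field_simp
    rw [hx, div_pow, div_le_iff₀ (by positivity)]
    obtain ⟨e, he, rfl⟩ : ∃ e, 0 ≤ e ∧ M = 2 + e := ⟨M - 2, by linarith, by ring⟩
    ring_nf
    nlinarith [pow_nonneg he 2, pow_nonneg he 3, pow_nonneg he 4, pow_nonneg he 5,
      pow_nonneg he 6, pow_nonneg he 7]
  have hlog := Real.log_le_log (pow_pos hpos 4) hpow
  rw [Real.log_pow, Real.log_pow] at hlog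
  push_cast at hlog
  linarith

theorem measureReal_le_of_klDiv_le {μ ν : Measure Ω} [IsProbabilityMeasure μ]
    [IsProbabilityMeasure ν] {A : Set Ω} (hA : MeasurableSet A) {M : ℝ} (hM : 2 ≤ M)
    (hνA : ν.real A ≤ 1 / M) (hkl : klDiv μ ν ≤ ENNReal.ofReal (Real.log M / 8)) :
    μ.real A ≤ 7 / 8 := by
  have hlogM : 0 < Real.log M := Real.log_pos (by linarith)
  have hkl' : (klDiv μ ν).toReal ≤ Real.log M / 8 :=
    ENNReal.toReal_le_of_le_ofReal (by positivity) hkl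
  have hDV := mul_measureReal_le_klDiv_add_log (ne_top_of_le_ne_top ENNReal.ofReal_ne_top hkl) hA
    (Real.log M)
  have hlog : Real.log (1 + (M - 1) * ν.real A) ≤ Real.log (2 - 1 / M) := by
    refine Real.log_le_log ?_ ?_
    · have := mul_nonneg (by linarith : 0 ≤ M - 1) (measureReal_nonneg (μ := ν) (s := A))
      linarith
    · calc 1 + (M - 1) * ν.real A ≤ 1 + (M - 1) * (1 / M) := by gcongr; linarith
        _ = 2 - 1 / M := by field_simp; ring
  rw [Real.exp_log (by linarith)] at hDV
  have := eight_mul_log_two_sub_inv_le hM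
  nlinarith

theorem exists_measureReal_le_of_pairwise_disjoint {ι : Type*} [Fintype ι] [Nonempty ι]
    (μ : Measure Ω) [IsProbabilityMeasure μ] {A : ι → Set Ω} (hA : ∀ i, MeasurableSet (A i))
    (hdisj : Pairwise (Function.onFun Disjoint A)) : ∃ i, μ.real (A i) ≤ 1 / Fintype.card ι := by
  have hsum : ∑ i, μ.real (A i) ≤ ∑ _i : ι, 1 / (Fintype.card ι : ℝ) := by
    rw [Finset.sum_const, Finset.card_univ, nsmul_eq_mul,
      mul_one_div_cancel (by exact_mod_cast Fintype.card_ne_zero),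
      ← measureReal_biUnion_finset (fun i _ j _ hij => hdisj hij) fun i _ => hA i]
    exact measureReal_le_one
  obtain ⟨i, -, hi⟩ := Finset.exists_le_of_sum_le Finset.univ_nonempty hsum
  exact ⟨i, hi⟩

/- A Fano-type testing bound: the events `ψ i < s` are disjoint, so one of them is `μ₀`-unlikely,
and by the divergence bound it stays unlikely under `μ i`. -/
theorem exists_measureReal_ge_of_klDiv_le {ι : Type*} [Fintype ι] (hι : 2 ≤ Fintype.card ι)
    {μ₀ : Measure Ω} [IsProbabilityMeasure μ₀] {μ : ι → Measure Ω}
    [∀ i, IsProbabilityMeasure (μ i)]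
    (hkl : ∀ i, klDiv (μ i) μ₀ ≤ ENNReal.ofReal (Real.log (Fintype.card ι) / 8))
    {ψ : ι → Ω → ℝ} (hψ : ∀ i, Measurable (ψ i)) {s : ℝ}
    (hsep : ∀ i j, i ≠ j → ∀ ω, 2 * s ≤ ψ i ω + ψ j ω) :
    ∃ i, 1 / 8 ≤ (μ i).real {ω | s ≤ ψ i ω} := by
  have : Nonempty ι := Fintype.card_pos_iff.1 (by lia)
  have hmeas (i : ι) : MeasurableSet {ω | ψ i ω < s} := measurableSet_lt (hψ i) measurable_const
  have hdisj : Pairwise (Function.onFun Disjoint fun i => {ω | ψ i ω < s}) := fun i j hij =>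
    Set.disjoint_left.2 fun ω (hi : ψ i ω < s) (hj : ψ j ω < s) => by linarith [hsep i j hij ω]
  obtain ⟨i, hi⟩ := exists_measureReal_le_of_pairwise_disjoint μ₀ hmeas hdisj
  refine ⟨i, ?_⟩
  have hcompl : {ω | s ≤ ψ i ω} = {ω | ψ i ω < s}ᶜ := by ext; simp
  rw [hcompl, probReal_compl_eq_one_sub (hmeas i)]
  linarith [measureReal_le_of_klDiv_le (hmeas i) (by exact_mod_cast hι) hi (hkl i)]

theorem klDiv_tilted_tilted {ν : Measure Ω} [NeZero ν] {f g : Ω → ℝ}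
    (hf : Integrable (fun ω => Real.exp (f ω)) ν)
    (hg : Integrable (fun ω => Real.exp (g ω)) ν) (hfg : Integrable (f - g) (ν.tilted f)) :
    klDiv (ν.tilted f) (ν.tilted g) = ENNReal.ofReal (∫ ω, (f - g) ω ∂(ν.tilted f) -
      Real.log (∫ ω, Real.exp (f ω) ∂ν) + Real.log (∫ ω, Real.exp (g ω) ∂ν)) := by
  have := isProbabilityMeasure_tilted hf
  have := isProbabilityMeasure_tilted hg
  have hfg_tilted : (ν.tilted g).tilted (f - g) = ν.tilted f := by
    rw [tilted_tilted hg, add_sub_cancel]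
  have hexp : Integrable (fun ω => Real.exp ((f - g) ω)) (ν.tilted g) := by
    rw [integrable_tilted_iff hg]
    refine hf.congr (Eventually.of_forall fun ω => ?_)
    simp [← Real.exp_add]
  have hac : ν.tilted f ≪ ν.tilted g := hfg_tilted ▸ tilted_absolutelyContinuous _ _
  have hllr : llr (ν.tilted f) (ν.tilted g) =ᵐ[ν.tilted f] fun ω => (f - g) ω -
      (Real.log (∫ ω, Real.exp (f ω) ∂ν) - Real.log (∫ ω, Real.exp (g ω) ∂ν)) := by
    have h := log_rnDeriv_tilted_left_self hexp
    rw [hfg_tilted, integral_exp_tilted, add_sub_cancel, Real.log_div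
      (integral_exp_pos hf).ne' (integral_exp_pos hg).ne'] at h
    exact hac.ae_eq h
  rw [klDiv_of_ac_of_integrable hac ((integrable_congr hllr).2 (hfg.sub (integrable_const _))),
    integral_congr_ae hllr, integral_sub hfg (integrable_const _), integral_const]
  simp only [probReal_univ, one_smul]
  congr 1
  ring

end InformationTheory

section ExponentialFamily

variable {E : Type*} [NormedAddCommGroup E] [NormedSpace ℝ E] [FiniteDimensional ℝ E]

theorem exists_finset_exp_norm_le_sum_exp :
    ∃ F : Finset E, ∀ L : E →L[ℝ] ℝ, Real.exp ‖L‖ ≤ ∑ v ∈ F, Real.exp (L v) := by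
  classical
  let b := Module.finBasis ℝ E
  obtain ⟨C, -, hb⟩ := b.exists_opNorm_le (F := ℝ)
  refine ⟨insert 0 (Finset.univ.image (fun i => C • b i) ∪ Finset.univ.image fun i => -(C • b i)),
    fun L => ?_⟩
  have hle {v : E} (hv : v ∈ insert 0 (Finset.univ.image (fun i => C • b i) ∪
      Finset.univ.image fun i => -(C • b i))) (hLv : ‖L‖ ≤ L v) :=
    (Real.exp_le_exp.2 hLv).trans
      (Finset.single_le_sum (f := fun v => Real.exp (L v)) (fun _ _ => (Real.exp_pos _).le) hv)
  rcases isEmpty_or_nonempty (Fin (Module.finrank ℝ E)) with h | h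
  · exact hle (Finset.mem_insert_self _ _)
      (by simpa using hb (u := L) le_rfl fun i => isEmptyElim i)
  obtain ⟨i, hi⟩ := Finite.exists_max fun i => ‖L (b i)‖
  have hL : ‖L‖ ≤ C * |L (b i)| := hb (abs_nonneg _) hi
  rcases abs_cases (L (b i)) with ⟨habs, -⟩ | ⟨habs, -⟩ <;> rw [habs] at hL
  · exact hle (v := C • b i) (by simp) (by simpa using hL)
  · exact hle (v := -(C • b i)) (by simp) (by simpa using hL)

variable {Ω : Type*} [MeasurableSpace Ω] {ν : Measure Ω} {T : Ω → E →L[ℝ] ℝ} {η : E}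

theorem exists_integrable_exp_add_norm (hT : AEStronglyMeasurable T ν)
    (hη : ∀ᶠ η' in 𝓝 η, Integrable (fun ω => Real.exp (T ω η')) ν) :
    ∃ ε > 0, Integrable (fun ω => Real.exp (T ω η + ε * ‖T ω‖)) ν := by
  obtain ⟨F, hF⟩ := exists_finset_exp_norm_le_sum_exp (E := E)
  have hdir : ∀ v ∈ F, ∀ᶠ ε : ℝ in 𝓝[>] 0,
      Integrable (fun ω => Real.exp (T ω (η + ε • v))) ν := by
    intro v _
    have hlim : Tendsto (fun ε : ℝ => η + ε • v) (𝓝 0) (𝓝 η) := by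
      have : Continuous fun ε : ℝ => η + ε • v := by fun_prop
      simpa using this.tendsto 0
    exact (hlim.mono_left nhdsWithin_le_nhds).eventually hη
  obtain ⟨ε, hε, hint⟩ :=
    (((eventually_all_finset F).2 hdir).and self_mem_nhdsWithin).exists.imp fun _ h => h.symm
  refine ⟨ε, hε, (integrable_finsetSum F hint).mono' ?_ (Eventually.of_forall fun ω => ?_)⟩
  · exact Real.continuous_exp.comp_aestronglyMeasurable
      ((hT.apply_continuousLinearMap η).add (hT.norm.const_mul ε))
  · calc ‖Real.exp (T ω η + ε * ‖T ω‖)‖ = Real.exp (T ω η) * Real.exp ‖ε • T ω‖ := by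
          rw [Real.norm_eq_abs, Real.abs_exp, Real.exp_add, norm_smul, Real.norm_of_nonneg hε.le]
      _ ≤ Real.exp (T ω η) * ∑ v ∈ F, Real.exp ((ε • T ω) v) := by gcongr; exact hF _
      _ = ∑ v ∈ F, Real.exp (T ω (η + ε • v)) := by
          simp only [Finset.mul_sum, ← Real.exp_add, map_add, map_smul, smul_apply]

theorem exp_mul_le_exp_add {ε : ℝ} (hε : 0 < ε) (a x : ℝ) :
    Real.exp (a + ε / 2 * x) * x ≤ 2 / ε * Real.exp (a + ε * x) := by
  have hx : x ≤ 2 / ε * Real.exp (ε / 2 * x) := by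
    have h := (le_add_of_nonneg_right zero_le_one).trans (Real.add_one_le_exp (ε / 2 * x))
    calc x = 2 / ε * (ε / 2 * x) := by field_simp
      _ ≤ 2 / ε * Real.exp (ε / 2 * x) := by gcongr
  calc Real.exp (a + ε / 2 * x) * x
      ≤ Real.exp (a + ε / 2 * x) * (2 / ε * Real.exp (ε / 2 * x)) := by gcongr
    _ = 2 / ε * Real.exp (a + ε * x) := by
        rw [mul_left_comm, ← Real.exp_add]
        ring_nf

theorem integrable_exp_smul (hT : AEStronglyMeasurable T ν)
    (hη : ∀ᶠ η' in 𝓝 η, Integrable (fun ω => Real.exp (T ω η')) ν) :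
    Integrable (fun ω => Real.exp (T ω η) • T ω) ν := by
  obtain ⟨ε, hε, hint⟩ := exists_integrable_exp_add_norm hT hη
  refine (hint.const_mul (2 / ε)).mono'
    ((Real.continuous_exp.comp_aestronglyMeasurable (hT.apply_continuousLinearMap η)).smul hT)
    (Eventually.of_forall fun ω => ?_)
  rw [norm_smul, Real.norm_eq_abs, Real.abs_exp]
  refine le_trans ?_ (exp_mul_le_exp_add hε (T ω η) ‖T ω‖)
  gcongr
  exact le_add_of_nonneg_right (by positivity)

theorem hasFDerivAt_integral_exp (hT : AEStronglyMeasurable T ν)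
    (hη : ∀ᶠ η' in 𝓝 η, Integrable (fun ω => Real.exp (T ω η')) ν) :
    HasFDerivAt (fun η => ∫ ω, Real.exp (T ω η) ∂ν) (∫ ω, Real.exp (T ω η) • T ω ∂ν) η := by
  obtain ⟨ε, hε, hint⟩ := exists_integrable_exp_add_norm hT hη
  refine hasFDerivAt_integral_of_dominated_of_fderiv_le
    (F' := fun η ω => Real.exp (T ω η) • T ω)
    (bound := fun ω => 2 / ε * Real.exp (T ω η + ε * ‖T ω‖))
    (Metric.ball_mem_nhds η (half_pos hε)) (hη.mono fun _ h => h.aestronglyMeasurable)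
    hη.self_of_nhds (integrable_exp_smul hT hη).aestronglyMeasurable
    (Eventually.of_forall fun ω η' hη' => ?_) (hint.const_mul _)
    (Eventually.of_forall fun ω η' _ => (T ω).hasFDerivAt.exp)
  have hle : T ω η' ≤ T ω η + ε / 2 * ‖T ω‖ := by
    have h := (Real.le_norm_self _).trans ((T ω).le_opNorm (η' - η))
    rw [map_sub, mul_comm] at h
    have := mul_le_mul_of_nonneg_right (mem_ball_iff_norm.1 hη').le (norm_nonneg (T ω))
    linarith
  rw [norm_smul, Real.norm_eq_abs, Real.abs_exp]
  refine le_trans ?_ (exp_mul_le_exp_add hε (T ω η) ‖T ω‖)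
  gcongr

theorem hasFDerivAt_log_integral_exp [NeZero ν] (hT : AEStronglyMeasurable T ν)
    (hη : ∀ᶠ η' in 𝓝 η, Integrable (fun ω => Real.exp (T ω η')) ν) :
    HasFDerivAt (fun η => Real.log (∫ ω, Real.exp (T ω η) ∂ν))
      (∫ ω, T ω ∂(ν.tilted fun ω => T ω η)) η := by
  have h := (hasFDerivAt_integral_exp hT hη).log (integral_exp_pos hη.self_of_nhds).ne'
  rw [integral_tilted]
  simp_rw [div_eq_inv_mul, mul_smul, integral_smul]
  exact h

/- `ψ` is the log-partition function up to a linear term, which does not affect its Bregman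
divergence. -/
theorem klDiv_tilted_eq_bregman [NeZero ν] (hT : AEStronglyMeasurable T ν)
    (hη : ∀ᶠ η' in 𝓝 η, Integrable (fun ω => Real.exp (T ω η')) ν) {η₀ : E}
    (hη₀ : Integrable (fun ω => Real.exp (T ω η₀)) ν) (L : E →L[ℝ] ℝ) {ψ : E → ℝ}
    (hψ : ψ = fun η => Real.log (∫ ω, Real.exp (T ω η) ∂ν) - L η) :
    klDiv (ν.tilted fun ω => T ω η) (ν.tilted fun ω => T ω η₀) =
      ENNReal.ofReal (ψ η₀ - ψ η - fderiv ℝ ψ η (η₀ - η)) := by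
  have hint : Integrable T (ν.tilted fun ω => T ω η) :=
    (integrable_tilted_iff hη.self_of_nhds T).2 (integrable_exp_smul hT hη)
  have hsub : ((fun ω => T ω η) - fun ω => T ω η₀) = fun ω => -T ω (η₀ - η) := by
    ext ω
    simp
  have hderiv : fderiv ℝ ψ η = ∫ ω, T ω ∂(ν.tilted fun ω => T ω η) - L :=
    hψ ▸ ((hasFDerivAt_log_integral_exp hT hη).sub L.hasFDerivAt).fderiv
  rw [klDiv_tilted_tilted hη.self_of_nhds hη₀
    (hsub ▸ (hint.apply_continuousLinearMap (η₀ - η)).neg), hsub, integral_neg, hderiv, hψ,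
    sub_apply, ContinuousLinearMap.integral_apply hint, map_sub L]
  congr 1
  ring

end ExponentialFamily

section GeneralizedLinearModel

theorem measurable_entry (i : Fin n) (j : Fin m) :
    Measurable fun A : Matrix (Fin n) (Fin m) ℝ => A i j :=
  (measurable_pi_apply j).comp
    (measurable_pi_apply i : Measurable fun A : Fin n → Fin m → ℝ => A i)

/-- The functional `η ↦ ⟨y, η⟩ / σ²`, through which an observation `y` enters the density of `P_η`.
Its domain is the matrix space written as a function space, which carries the sup norm. -/
noncomputable def naturalPairing (σ : ℝ) (y : Matrix (Fin n) (Fin m) ℝ) :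
    (Fin n → Fin m → ℝ) →L[ℝ] ℝ :=
  ∑ i, ∑ j, (y i j / σ ^ 2) • ((ContinuousLinearMap.proj j : (Fin m → ℝ) →L[ℝ] ℝ).comp
    (ContinuousLinearMap.proj i : (Fin n → Fin m → ℝ) →L[ℝ] Fin m → ℝ))

theorem naturalPairing_apply (σ : ℝ) (y : Matrix (Fin n) (Fin m) ℝ) (η : Fin n → Fin m → ℝ) :
    naturalPairing σ y η = frobInner y (Matrix.of η) / σ ^ 2 := by
  simp only [naturalPairing, frobInner, sum_apply, smul_apply, ContinuousLinearMap.comp_apply,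
    ContinuousLinearMap.proj_apply, smul_eq_mul, Matrix.of_apply, Finset.sum_div,
    div_mul_eq_mul_div]

theorem stronglyMeasurable_naturalPairing (σ : ℝ) :
    StronglyMeasurable (naturalPairing (n := n) (m := m) σ) := by
  unfold naturalPairing
  exact Finset.stronglyMeasurable_fun_sum _ fun i _ => Finset.stronglyMeasurable_fun_sum _
    fun j _ => ((measurable_entry i j).div_const (σ ^ 2)).stronglyMeasurable.smul_const _

variable {σ : ℝ} {ν : Measure (Matrix (Fin n) (Fin m) ℝ)} {η η₀ : Matrix (Fin n) (Fin m) ℝ}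

theorem glmLaw_eq_tilted [NeZero ν] (hσ : σ ≠ 0) (hη : η ∈ naturalSpace ν σ) :
    glmLaw ν σ η = ν.tilted fun y => frobInner y η / σ ^ 2 := by
  have hpos : 0 < ∫ y, Real.exp (frobInner y η / σ ^ 2) ∂ν := integral_exp_pos hη
  simp only [glmLaw, Measure.tilted, cumulant, sub_div,
    mul_div_cancel_left₀ _ (pow_ne_zero 2 hσ), Real.exp_sub, Real.exp_log hpos]

theorem isProbabilityMeasure_glmLaw [NeZero ν] (hσ : σ ≠ 0) (hη : η ∈ naturalSpace ν σ) :
    IsProbabilityMeasure (glmLaw ν σ η) := by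
  rw [glmLaw_eq_tilted hσ hη]
  exact isProbabilityMeasure_tilted hη

theorem klDiv_glmLaw [NeZero ν] (hσ : σ ≠ 0) (hreg : IsOpen (naturalSpace ν σ))
    (hη : η ∈ naturalSpace ν σ) (hη₀ : η₀ ∈ naturalSpace ν σ) (Y : Matrix (Fin n) (Fin m) ℝ) :
    klDiv (glmLaw ν σ η) (glmLaw ν σ η₀) = ENNReal.ofReal (bregman (glmLoss ν σ Y) η₀ η) := by
  obtain ⟨η, rfl⟩ := Matrix.of.surjective η
  obtain ⟨η₀, rfl⟩ := Matrix.of.surjective η₀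
  have hloss : (fun η => glmLoss ν σ Y (Matrix.of η)) =
      fun η => Real.log (∫ y, Real.exp (naturalPairing σ y η) ∂ν) - naturalPairing σ Y η := by
    ext η
    simp only [glmLoss, cumulant, naturalPairing_apply, add_div,
      mul_div_cancel_left₀ _ (pow_ne_zero 2 hσ)]
    ring
  have hdom (η : Fin n → Fin m → ℝ) (h : Matrix.of η ∈ naturalSpace ν σ) :
      Integrable (fun y => Real.exp (naturalPairing σ y η)) ν := by
    simp_rw [naturalPairing_apply]
    exact h
  rw [glmLaw_eq_tilted hσ hη, glmLaw_eq_tilted hσ hη₀]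
  simp_rw [← naturalPairing_apply]
  exact klDiv_tilted_eq_bregman (stronglyMeasurable_naturalPairing σ).aestronglyMeasurable
    (eventually_of_mem (hreg.mem_nhds hη) hdom) (hdom η₀ hη₀) (naturalPairing σ Y) hloss

end GeneralizedLinearModel

section Codes

variable {ι α : Type*} [Fintype ι] [Fintype α] [DecidableEq α]

section

variable [DecidableEq ι]

theorem sum_pow_hammingDist {R : Type*} [CommSemiring R] (x : ι → α) (t : R) :
    ∑ w : ι → α, t ^ hammingDist w x =
      (1 + ((Fintype.card α - 1 : ℕ) : R) * t) ^ Fintype.card ι := by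
  have hletter (a : α) :
      ∑ b, (if b ≠ a then t else 1) = 1 + ((Fintype.card α - 1 : ℕ) : R) * t := by
    rw [Fintype.sum_eq_add_sum_compl a, if_neg (not_not.2 rfl),
      Finset.sum_congr rfl fun b hb => if_pos (by simpa using hb), Finset.sum_const,
      Finset.card_compl, Finset.card_singleton, nsmul_eq_mul]
  calc ∑ w : ι → α, t ^ hammingDist w x = ∑ w : ι → α, ∏ i, if w i ≠ x i then t else 1 :=
        Finset.sum_congr rfl fun w _ => by
          rw [hammingDist, Finset.prod_ite, Finset.prod_const, Finset.prod_const_one, mul_one]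
    _ = ∏ i, ∑ b, if b ≠ x i then t else 1 :=
        (Fintype.prod_sum fun i b => if b ≠ x i then t else 1).symm
    _ = _ := by simp only [hletter, Finset.prod_const, Finset.card_univ]

theorem card_hammingNorm_eq [Zero α] (i : ℕ) :
    #{w : ι → α | hammingNorm w = i} =
      (Fintype.card ι).choose i * (Fintype.card α - 1) ^ i := by
  have h := congrArg (Polynomial.coeff · i) (sum_pow_hammingDist (0 : ι → α) (Polynomial.X : ℕ[X]))
  rw [add_comm, add_pow] at h
  simp only [hammingDist_zero_right, Polynomial.finsetSum_coeff, Polynomial.coeff_X_pow, one_pow,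
    mul_one, mul_pow, ← Nat.cast_pow, Polynomial.coeff_mul_natCast, Polynomial.coeff_natCast_mul,
    ← Finset.card_filter, mul_ite, ite_mul, mul_zero, Nat.cast_id, zero_mul, Finset.sum_ite_eq',
    Finset.mem_range_succ_iff, eq_comm (a := i)] at h
  rw [h, mul_comm]
  split_ifs with hi
  · rfl
  · rw [Nat.choose_eq_zero_of_lt (not_le.1 hi), zero_mul]

theorem card_hammingNorm_le [Zero α] (ζ : ℕ) :
    #{w : ι → α | hammingNorm w ≤ ζ} =
      ∑ i ∈ Finset.range (ζ + 1), (Fintype.card ι).choose i * (Fintype.card α - 1) ^ i := by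
  rw [Finset.card_eq_sum_card_fiberwise (f := hammingNorm) (t := Finset.range (ζ + 1))
    fun w hw => by simpa [Nat.lt_succ_iff] using hw]
  refine Finset.sum_congr rfl fun i hi => ?_
  rw [← card_hammingNorm_eq, Finset.filter_filter]
  congr 1
  ext w
  have := Finset.mem_range.1 hi
  simp only [Finset.mem_filter_univ]
  lia

theorem card_hammingBall_mul_pow_le (x : ι → α) (D : ℕ) {t : ℝ} (ht₀ : 0 ≤ t) (ht₁ : t ≤ 1) :
    #{w | hammingDist w x ≤ D} * t ^ D ≤
      (1 + ((Fintype.card α - 1 : ℕ) : ℝ) * t) ^ Fintype.card ι := by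
  rw [← sum_pow_hammingDist x t, ← nsmul_eq_mul]
  calc #{w | hammingDist w x ≤ D} • t ^ D ≤ ∑ w with hammingDist w x ≤ D, t ^ hammingDist w x :=
        Finset.card_nsmul_le_sum _ _ _ fun w hw =>
          pow_le_pow_of_le_one ht₀ ht₁ (Finset.mem_filter.1 hw).2
    _ ≤ ∑ w, t ^ hammingDist w x := Finset.sum_le_univ_sum_of_nonneg fun w => by positivity

theorem card_hammingBall_pow_four_le (hα : 2 ≤ Fintype.card α) (x : ι → α) :
    #{w | hammingDist w x ≤ Fintype.card ι / 8} ^ 4 ≤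
      Fintype.card α ^ (3 * Fintype.card ι) := by
  set N := Fintype.card ι
  set D := N / 8
  set Q : ℝ := ((Fintype.card α : ℕ) : ℝ) with hQ
  have hQ2 : 2 ≤ Q := Nat.ofNat_le_cast.2 hα
  -- the Chernoff parameter `t = Q⁻²` beats the `Q - 1` competing letters
  have hbase : 1 + ((Fintype.card α - 1 : ℕ) : ℝ) * (Q ^ 2)⁻¹ ≤ 5 / 4 := by
    rw [Nat.cast_pred (by lia), ← hQ, ← div_eq_mul_inv]
    have : (Q - 1) / Q ^ 2 ≤ 1 / 4 := by
      rw [div_le_iff₀ (by positivity)]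
      nlinarith [sq_nonneg (Q - 2)]
    linarith
  have hball : (#{w | hammingDist w x ≤ D} : ℝ) ≤ (5 / 4) ^ N * Q ^ (2 * D) := by
    have h := (card_hammingBall_mul_pow_le x D (t := (Q ^ 2)⁻¹) (by positivity)
      (inv_le_one_of_one_le₀ (by nlinarith))).trans (pow_le_pow_left₀ (by positivity) hbase N)
    rwa [inv_pow, ← pow_mul, ← div_eq_mul_inv, div_le_iff₀ (by positivity)] at h
  have hreal : (#{w | hammingDist w x ≤ D} : ℝ) ^ 4 ≤ Q ^ (3 * N) := by
    calc (#{w | hammingDist w x ≤ D} : ℝ) ^ 4 ≤ ((5 / 4) ^ N * Q ^ (2 * D)) ^ 4 := by gcongr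
      _ = ((5 / 4) ^ 4) ^ N * Q ^ (8 * D) := by rw [mul_pow, pow_right_comm, ← pow_mul]; ring
      _ ≤ (Q ^ 2) ^ N * Q ^ N := by
          gcongr
          · nlinarith
          · linarith
          · lia
      _ = Q ^ (3 * N) := by ring
  rw [hQ] at hreal
  exact_mod_cast hreal

/- Gilbert–Varshamov: the balls of radius `D` around a maximal code of minimum distance above `D`
cover all words. -/
theorem exists_code_of_card_hammingBall_le (D : ℕ) {v : ℕ}
    (hv : ∀ x : ι → α, #{w | hammingDist w x ≤ D} ≤ v) :
    ∃ S : Finset (ι → α), (∀ x ∈ S, ∀ y ∈ S, x ≠ y → D < hammingDist x y) ∧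
      Fintype.card α ^ Fintype.card ι ≤ #S * v := by
  obtain ⟨S, hS⟩ := (Set.toFinite {S : Finset (ι → α) |
    ∀ x ∈ S, ∀ y ∈ S, x ≠ y → D < hammingDist x y}).exists_maximal ⟨∅, by simp⟩
  have hcover (w : ι → α) : ∃ x ∈ S, hammingDist w x ≤ D := by
    by_contra! hfar
    have hinsert : ∀ x ∈ insert w S, ∀ y ∈ insert w S, x ≠ y → D < hammingDist x y := by
      simp only [Finset.forall_mem_insert]
      refine ⟨⟨fun h => absurd rfl h, fun y hy _ => hfar y hy⟩, fun x hx => ⟨fun _ => ?_, ?_⟩⟩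
      · exact hammingDist_comm w x ▸ hfar x hx
      · exact hS.prop x hx
    have hw : w ∈ S := hS.le_of_ge hinsert (Finset.subset_insert w S) (Finset.mem_insert_self w S)
    simpa using hfar w hw
  refine ⟨S, hS.prop, ?_⟩
  calc Fintype.card α ^ Fintype.card ι = #(Finset.univ : Finset (ι → α)) := by simp
    _ ≤ #(S.biUnion fun x => {w | hammingDist w x ≤ D}) :=
        Finset.card_le_card fun w _ => by simpa using hcover w
    _ ≤ #S * v := Finset.card_biUnion_le_card_mul _ _ _ fun x _ => hv x

end

theorem exists_code (hα : 2 ≤ Fintype.card α) :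
    ∃ S : Finset (ι → α),
      (∀ x ∈ S, ∀ y ∈ S, x ≠ y → Fintype.card ι ≤ 8 * hammingDist x y) ∧
      Fintype.card α ^ Fintype.card ι ≤ #S ^ 4 := by
  classical
  set N := Fintype.card ι
  have : Nonempty α := Fintype.card_pos_iff.1 (by lia)
  obtain ⟨x, hx⟩ := Finite.exists_max fun x : ι → α => #{w | hammingDist w x ≤ N / 8}
  obtain ⟨S, hS, hcard⟩ := exists_code_of_card_hammingBall_le (N / 8) hx
  refine ⟨S, fun x hx y hy hxy => by have := hS x hx y hy hxy; lia, ?_⟩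
  refine Nat.le_of_mul_le_mul_right ?_ (Nat.pow_pos (n := 3 * N) (by lia : 0 < Fintype.card α))
  calc Fintype.card α ^ N * Fintype.card α ^ (3 * N) = (Fintype.card α ^ N) ^ 4 := by ring
    _ ≤ (#S * #{w | hammingDist w x ≤ N / 8}) ^ 4 := Nat.pow_le_pow_left hcard 4
    _ ≤ #S ^ 4 * Fintype.card α ^ (3 * N) := by
        rw [mul_pow]
        exact Nat.mul_le_mul_left _ (card_hammingBall_pow_four_le hα x)

theorem exists_dictionary {q r b ζ : ℕ} (h : Admissible q r b ζ) :
    ∃ v : Fin q → Fin r → ℕ, Function.Injective v ∧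
      ∀ k, ∑ j, (v k j : ℝ) ^ 2 ≤ (b : ℝ) ^ 2 * ζ := by
  obtain ⟨hb, -, -, hq⟩ := h
  have : NeZero b := ⟨by lia⟩
  obtain ⟨f⟩ : Nonempty (Fin q ↪ {w : Fin r → Fin b // hammingNorm w ≤ ζ}) := by
    refine Function.Embedding.nonempty_of_card_le ?_
    rwa [Fintype.card_subtype, card_hammingNorm_le, Fintype.card_fin, Fintype.card_fin,
      Fintype.card_fin]
  refine ⟨fun k j => (f k).1 j, fun k k' hkk => ?_, fun k => ?_⟩
  · exact f.injective (Subtype.ext (funext fun j => Fin.ext (congrFun hkk j)))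
  · calc ∑ j, (((f k).1 j : ℕ) : ℝ) ^ 2
        = ∑ j with (f k).1 j ≠ 0, (((f k).1 j : ℕ) : ℝ) ^ 2 :=
          (Finset.sum_filter_of_ne fun j _ hj h0 => by simp [h0] at hj).symm
      _ ≤ #{j | (f k).1 j ≠ 0} • (b : ℝ) ^ 2 :=
          Finset.sum_le_card_nsmul _ _ _ fun j _ => by
            have : (((f k).1 j : ℕ) : ℝ) ≤ b := by exact_mod_cast ((f k).1 j).2.le
            gcongr
      _ ≤ (b : ℝ) ^ 2 * ζ := by
          rw [nsmul_eq_mul, mul_comm]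
          gcongr
          exact (f k).2

end Codes

section Matrices

variable {k l : ℕ}

theorem measurable_matrix {α : Type*} [MeasurableSpace α] {f : α → Matrix (Fin n) (Fin m) ℝ}
    (hf : ∀ i j, Measurable fun a => f a i j) : Measurable f :=
  measurable_pi_lambda (fun a => (f a : Fin n → Fin m → ℝ)) fun i =>
    measurable_pi_lambda (fun a => f a i) (hf i)

theorem measurable_frobSq : Measurable (frobSq : Matrix (Fin n) (Fin m) ℝ → ℝ) :=
  Finset.measurable_fun_sum _ fun i _ => Finset.measurable_fun_sum _ fun j _ =>
    (measurable_entry i j).pow_const 2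

theorem measurable_const_sub_mul (C : Matrix (Fin l) (Fin m) ℝ) (A : Matrix (Fin l) (Fin p) ℝ) :
    Measurable fun B : Matrix (Fin p) (Fin m) ℝ => C - A * B :=
  measurable_matrix fun i j => Measurable.const_sub
    (by simpa only [Matrix.mul_apply] using
      Finset.measurable_fun_sum _ fun x _ => (measurable_entry x j).const_mul (A i x)) (C i j)

theorem frobSq_neg (A : Matrix (Fin n) (Fin m) ℝ) : frobSq (-A) = frobSq A := by
  simp only [frobSq, Matrix.neg_apply, neg_sq]

theorem frobSq_smul (c : ℝ) (A : Matrix (Fin n) (Fin m) ℝ) :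
    frobSq (c • A) = c ^ 2 * frobSq A := by
  simp only [frobSq, Finset.mul_sum, Matrix.smul_apply, smul_eq_mul, mul_pow]

theorem frobSq_sub_le (A B C : Matrix (Fin n) (Fin m) ℝ) :
    frobSq (A - B) ≤ 2 * (frobSq (A - C) + frobSq (B - C)) := by
  simp only [frobSq, Finset.mul_sum, ← Finset.sum_add_distrib, Matrix.sub_apply]
  refine Finset.sum_le_sum fun i _ => Finset.sum_le_sum fun j _ => ?_
  linarith [sq_nonneg (A i j + B i j - 2 * C i j)]

theorem frobSq_eq_trace (A : Matrix (Fin n) (Fin m) ℝ) :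
    frobSq A = (Aᵀ * A).trace := by
  simp only [frobSq, Matrix.trace, Matrix.diag_apply, Matrix.mul_apply, Matrix.transpose_apply, sq]
  exact Finset.sum_comm

theorem frobSq_mul_of_transpose_mul_self {E : Matrix (Fin k) (Fin n) ℝ} (hE : Eᵀ * E = 1)
    (A : Matrix (Fin n) (Fin m) ℝ) : frobSq (E * A) = frobSq A := by
  rw [frobSq_eq_trace, frobSq_eq_trace, Matrix.transpose_mul, Matrix.mul_assoc,
    ← Matrix.mul_assoc Eᵀ, hE, Matrix.one_mul]

theorem frobSq_mul_transpose_of_transpose_mul_self {E : Matrix (Fin k) (Fin m) ℝ}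
    (hE : Eᵀ * E = 1) (A : Matrix (Fin n) (Fin m) ℝ) :
    frobSq (A * Eᵀ) = frobSq A := by
  rw [frobSq_eq_trace, frobSq_eq_trace, Matrix.transpose_mul, Matrix.transpose_transpose,
    Matrix.mul_assoc, Matrix.trace_mul_comm, Matrix.mul_assoc, Matrix.mul_assoc, hE,
    Matrix.mul_one]

/-- The `k × n` matrix with columns `e_{f j}`: for injective `f`, left multiplication by it places
row `j` in position `f j` and fills the other rows with zeros. -/
def rowEmbedding (f : Fin n → Fin k) : Matrix (Fin k) (Fin n) ℝ :=
  (1 : Matrix (Fin k) (Fin k) ℝ).submatrix id f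

theorem mul_rowEmbedding (A : Matrix (Fin m) (Fin k) ℝ) (f : Fin n → Fin k) :
    A * rowEmbedding f = A.submatrix id f := by
  ext i j
  simp [rowEmbedding, Matrix.mul_apply, Matrix.one_apply]

theorem rowEmbedding_transpose_mul_self {f : Fin n → Fin k} (hf : Function.Injective f) :
    (rowEmbedding f)ᵀ * rowEmbedding f = 1 := by
  rw [mul_rowEmbedding, rowEmbedding, Matrix.transpose_submatrix, Matrix.transpose_one,
    Matrix.submatrix_submatrix]
  exact Matrix.submatrix_one f hf

theorem exists_mul_rowEmbedding_mul_eq_one {A : Matrix (Fin k) (Fin p) ℝ} (hA : A.rank = k) :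
    ∃ (f : Fin k → Fin p) (R : Matrix (Fin k) (Fin k) ℝ), A * (rowEmbedding f * R) = 1 := by
  obtain ⟨κ, g, hg, hspan, hli⟩ := exists_linearIndependent' ℝ A.col
  have : Fintype κ := @Fintype.ofFinite κ (Finite.of_injective g hg)
  have hcard : Fintype.card κ = k := by
    rw [← finrank_span_eq_card hli, hspan, ← Matrix.rank_eq_finrank_span_cols, hA]
  have e : Fin k ≃ κ := (Fintype.equivFinOfCardEq hcard).symm
  have hunit : IsUnit (A.submatrix id (g ∘ e)) :=
    Matrix.linearIndependent_cols_iff_isUnit.1 (hli.comp e e.injective)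
  refine ⟨g ∘ e, (A.submatrix id (g ∘ e))⁻¹, ?_⟩
  rw [← Matrix.mul_assoc, mul_rowEmbedding,
    Matrix.mul_nonsing_inv _ ((Matrix.isUnit_iff_isUnit_det _).1 hunit)]

theorem numDistinctRows_mul_le (A : Matrix (Fin n) (Fin k) ℝ) (B : Matrix (Fin k) (Fin m) ℝ) :
    numDistinctRows (A * B) ≤ numDistinctRows A := by
  have hrange : (Set.range fun i => (A * B).row i) =
      (fun u => Matrix.vecMul u B) '' Set.range fun i => A.row i := by
    rw [← Set.range_comp]
    rfl
  rw [numDistinctRows, hrange]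
  exact Set.ncard_image_le (Set.finite_range _)

theorem numDistinctRows_of_comp_le (v : Fin k → Fin m → ℝ) (w : Fin n → Fin k) :
    numDistinctRows (Matrix.of fun i => v (w i)) ≤ k := by
  calc numDistinctRows (Matrix.of fun i => v (w i))
      ≤ (Set.range v).ncard :=
        Set.ncard_le_ncard (Set.range_comp_subset_range w v) (Set.finite_range v)
    _ ≤ k := by
        simpa [Set.image_univ, Set.ncard_univ] using Set.ncard_image_le (f := v) Set.finite_univ

theorem numDistinctRows_rowEmbedding_le (f : Fin n → Fin k) :
    numDistinctRows (rowEmbedding f) ≤ n + 1 := by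
  set v : Fin n → Fin n → ℝ := fun i => (rowEmbedding f).row (f i)
  have hrange : (Set.range fun x => (rowEmbedding f).row x) ⊆ insert 0 (Set.range v) := by
    rintro _ ⟨x, rfl⟩
    by_cases hx : x ∈ Set.range f
    · obtain ⟨i, rfl⟩ := hx
      exact Or.inr ⟨i, rfl⟩
    · exact Or.inl (funext fun i => Matrix.one_apply_ne fun h => hx ⟨i, h.symm⟩)
  calc numDistinctRows (rowEmbedding f)
      ≤ (insert 0 (Set.range v)).ncard := Set.ncard_le_ncard hrange
    _ ≤ (Set.range v).ncard + 1 := Set.ncard_insert_le _ _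
    _ ≤ n + 1 := Nat.add_le_add_right (numDistinctRows_of_comp_le v id) 1

theorem numDistinctRows_rowEmbedding_mul_le (f : Fin n → Fin k) (A : Matrix (Fin n) (Fin m) ℝ) :
    numDistinctRows (rowEmbedding f * A) ≤ n + 1 :=
  (numDistinctRows_mul_le _ A).trans (numDistinctRows_rowEmbedding_le f)

theorem zero_mem_signalClass {q r : ℕ} (hq : 1 ≤ q) :
    (0 : Matrix (Fin p) (Fin m) ℝ) ∈ signalClass p m q r :=
  ⟨(numDistinctRows_of_comp_le (k := 1) 0 0).trans hq, by simp⟩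

end Matrices
section Packings

variable {k : ℕ}

/-- `S` has packings of complexity `τ`: at every scale `a > 0` it contains a family of `M ≥ 2`
matrices with squared norms at most `a log M` and pairwise squared distances at least `a τ`.
The common scale is what the curvature condition calibrates in a Fano-type argument. -/
def HasPacking (S : Set (Matrix (Fin k) (Fin m) ℝ)) (τ : ℝ) : Prop :=
  ∀ a : ℝ, 0 < a → ∃ (ι : Type) (_ : Fintype ι) (C : ι → Matrix (Fin k) (Fin m) ℝ),
    2 ≤ Fintype.card ι ∧ (∀ i, C i ∈ S) ∧
    (∀ i, frobSq (C i) ≤ a * Real.log (Fintype.card ι)) ∧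
    ∀ i j, i ≠ j → a * τ ≤ frobSq (C i - C j)

theorem HasPacking.mono {S S' : Set (Matrix (Fin k) (Fin m) ℝ)} {τ τ' : ℝ} (h : HasPacking S τ)
    (hS : S ⊆ S') (hτ : τ' ≤ τ) : HasPacking S' τ' := by
  intro a ha
  obtain ⟨ι, _, C, hι, hC, hnorm, hsep⟩ := h a ha
  exact ⟨ι, _, C, hι, fun i => hS (hC i), hnorm, fun i j hij =>
    (mul_le_mul_of_nonneg_left hτ ha.le).trans (hsep i j hij)⟩

theorem HasPacking.max {S : Set (Matrix (Fin k) (Fin m) ℝ)} {τ τ' : ℝ} (h : HasPacking S τ)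
    (h' : HasPacking S τ') : HasPacking S (max τ τ') := by
  rcases max_choice τ τ' with hmax | hmax <;> rwa [hmax]

theorem two_le_and_mul_log_le_log_of_pow_le_pow_four {Q N M : ℕ} (hQ : 2 ≤ Q) (hN : N ≠ 0)
    (h : Q ^ N ≤ M ^ 4) : 2 ≤ M ∧ N * Real.log Q / 4 ≤ Real.log M := by
  have hpow : 1 < Q ^ N := Nat.one_lt_pow hN hQ
  refine ⟨(Nat.one_lt_pow_iff four_ne_zero).1 (hpow.trans_le h), ?_⟩
  have hlog : Real.log ((Q : ℝ) ^ N) ≤ Real.log ((M : ℝ) ^ 4) :=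
    Real.log_le_log (by positivity) (by exact_mod_cast h)
  rw [Real.log_pow, Real.log_pow] at hlog
  push_cast at hlog
  linarith

theorem hasPacking_of_words {κ α : Type} [Fintype κ] [Nonempty κ] [Fintype α] [DecidableEq α]
    (hα : 2 ≤ Fintype.card α) {P : (κ → α) → Matrix (Fin k) (Fin m) ℝ}
    {S : Set (Matrix (Fin k) (Fin m) ℝ)} (hPS : ∀ (c : ℝ) w, c • P w ∈ S) {h : ℝ} (hh : 0 < h)
    (hnorm : ∀ w, frobSq (P w) ≤ Fintype.card κ * h)
    (hdist : ∀ w w', (hammingDist w w' : ℝ) ≤ frobSq (P w - P w')) :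
    HasPacking S (Fintype.card κ * Real.log (Fintype.card α) / (32 * h)) := by
  intro a ha
  obtain ⟨T, hsep, hcard⟩ := exists_code (ι := κ) hα
  obtain ⟨hT, hlog⟩ := two_le_and_mul_log_le_log_of_pow_le_pow_four hα Fintype.card_ne_zero hcard
  set θ : ℝ := a * Real.log (Fintype.card α) / (4 * h) with hθ
  have hθ₀ : 0 ≤ θ := by positivity
  refine ⟨T, inferInstance, fun w => √θ • P w, ?_, fun w => hPS _ _, fun w => ?_,
    fun w w' hww => ?_⟩
  · rwa [Fintype.card_coe]
  · rw [frobSq_smul, Real.sq_sqrt hθ₀, Fintype.card_coe]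
    calc θ * frobSq (P w) ≤ θ * (Fintype.card κ * h) := by gcongr; exact hnorm w
      _ = a * (Fintype.card κ * Real.log (Fintype.card α) / 4) := by rw [hθ]; field_simp
      _ ≤ a * Real.log #T := by gcongr
  · rw [← smul_sub, frobSq_smul, Real.sq_sqrt hθ₀]
    have hham : (Fintype.card κ : ℝ) ≤ 8 * hammingDist w.1 w'.1 := by
      exact_mod_cast hsep w.1 w.2 w'.1 w'.2 fun h => hww (Subtype.ext h)
    calc a * (Fintype.card κ * Real.log (Fintype.card α) / (32 * h))
        = θ * (Fintype.card κ / 8) := by rw [hθ]; field_simp; ring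
      _ ≤ θ * frobSq (P w - P w') := by
          gcongr
          linarith [hdist w.1 w'.1]

theorem card_ne_le_frobSq_sub (M M' : Matrix (Fin n) (Fin m) ℕ) :
    (#{x : Fin n × Fin m | M x.1 x.2 ≠ M' x.1 x.2} : ℝ) ≤
      frobSq (M.map (Nat.cast : ℕ → ℝ) - M'.map Nat.cast) := by
  rw [frobSq, ← Fintype.sum_prod_type', Finset.cast_card, Finset.sum_filter]
  refine Finset.sum_le_sum fun x _ => ?_
  split_ifs with hx
  · have hint : (1 : ℤ) ≤ ((M x.1 x.2 : ℤ) - M' x.1 x.2) ^ 2 :=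
      Int.add_one_le_iff.2 (sq_pos_of_ne_zero (by lia))
    rw [Matrix.sub_apply, Matrix.map_apply, Matrix.map_apply]
    exact_mod_cast hint
  · positivity

theorem hammingDist_rows_le_frobSq_sub (M M' : Matrix (Fin n) (Fin m) ℕ) :
    (hammingDist M.row M'.row : ℝ) ≤
      frobSq (M.map (Nat.cast : ℕ → ℝ) - M'.map Nat.cast) := by
  refine le_trans (Nat.cast_le.2 ?_) (card_ne_le_frobSq_sub M M')
  refine Finset.card_le_card_of_surjOn Prod.fst fun i hi => ?_
  obtain ⟨j, hj⟩ := Function.ne_iff.1 (Finset.mem_filter.1 hi).2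
  exact ⟨(i, j), by simpa using hj, rfl⟩

theorem hasPacking_block {a b : ℕ} (ha : 1 ≤ a) (hb : 1 ≤ b) (hak : a ≤ k) (hbm : b ≤ m) :
    HasPacking {C : Matrix (Fin k) (Fin m) ℝ |
      numDistinctRows C ≤ a + 1 ∧ C.rank ≤ a ∧ C.rank ≤ b} (a * b / 64) := by
  have : Nonempty (Fin a × Fin b) := ⟨⟨0, ha⟩, ⟨0, hb⟩⟩
  let E : Matrix (Fin k) (Fin a) ℝ := rowEmbedding (Fin.castLE hak)
  let F : Matrix (Fin m) (Fin b) ℝ := rowEmbedding (Fin.castLE hbm)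
  let N (w : Fin a × Fin b → Fin 2) : Matrix (Fin a) (Fin b) ℕ := fun i j => w (i, j)
  let W (w : Fin a × Fin b → Fin 2) : Matrix (Fin a) (Fin b) ℝ := (N w).map Nat.cast
  have hfrob (A : Matrix (Fin a) (Fin b) ℝ) : frobSq (E * A * Fᵀ) = frobSq A := by
    rw [frobSq_mul_transpose_of_transpose_mul_self
        (rowEmbedding_transpose_mul_self (Fin.castLE_injective hbm)),
      frobSq_mul_of_transpose_mul_self
        (rowEmbedding_transpose_mul_self (Fin.castLE_injective hak))]
  refine (hasPacking_of_words (P := fun w => E * W w * Fᵀ) (h := 1)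
    (Fintype.card_fin 2).ge (fun c w => ?_) one_pos (fun w => ?_) fun w w' => ?_).mono
    subset_rfl ?_
  · rw [Matrix.mul_assoc, ← Matrix.mul_smul, ← Matrix.smul_mul]
    refine ⟨numDistinctRows_rowEmbedding_mul_le _ _, ?_, ?_⟩
    · exact (Matrix.rank_mul_le_left _ _).trans (Matrix.rank_le_width _)
    · exact (Matrix.rank_mul_le_right _ _).trans
        ((Matrix.rank_mul_le_left _ _).trans (Matrix.rank_le_width _))
  · rw [hfrob, frobSq, ← Fintype.sum_prod_type', ← nsmul_eq_mul, ← Finset.card_univ]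
    refine Finset.sum_le_card_nsmul _ _ _ fun x _ => pow_le_one₀ (Nat.cast_nonneg _) ?_
    exact Nat.cast_le_one.2 (Nat.le_of_lt_succ (w x).2)
  · rw [← Matrix.sub_mul, ← Matrix.mul_sub, hfrob]
    refine le_trans (Nat.cast_le.2 ?_) (card_ne_le_frobSq_sub (N w) (N w'))
    exact Finset.card_le_card fun x hx => by simpa [N, Fin.ext_iff] using hx
  · rw [Fintype.card_prod, Fintype.card_fin, Fintype.card_fin, Fintype.card_fin, Nat.cast_mul]
    have hlog : 1 / 2 ≤ Real.log (2 : ℕ) := by exact_mod_cast by linarith [Real.log_two_gt_d9]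
    calc (a * b / 64 : ℝ) = a * b * (1 / 2) / (32 * 1) := by ring
      _ ≤ _ := by gcongr

theorem hasPacking_clusters {q r b ζ : ℕ} (hq : 2 ≤ q) (hp : 1 ≤ p) (hrm : r ≤ m)
    (hadm : Admissible q r b ζ) :
    HasPacking (signalClass p m q r) (p * Real.log q / (32 * ((b : ℝ) ^ 2 * ζ))) := by
  have : Nonempty (Fin p) := ⟨⟨0, hp⟩⟩
  obtain ⟨v, hv, hvnorm⟩ := exists_dictionary hadm
  let F : Matrix (Fin m) (Fin r) ℝ := rowEmbedding (Fin.castLE hrm)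
  let N (w : Fin p → Fin q) : Matrix (Fin p) (Fin r) ℕ := fun i => v (w i)
  let W (w : Fin p → Fin q) : Matrix (Fin p) (Fin r) ℝ := (N w).map Nat.cast
  have hfrob (A : Matrix (Fin p) (Fin r) ℝ) : frobSq (A * Fᵀ) = frobSq A :=
    frobSq_mul_transpose_of_transpose_mul_self
      (rowEmbedding_transpose_mul_self (Fin.castLE_injective hrm)) A
  have hpos : 0 < (b : ℝ) ^ 2 * ζ := by
    have hb : 0 < b := two_pos.trans_le hadm.1
    have hζ : 0 < ζ := hadm.2.1
    positivity
  have hpack : HasPacking (signalClass p m q r) _ :=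
    hasPacking_of_words (P := fun w => W w * Fᵀ) (by rwa [Fintype.card_fin])
      (fun c w => ?_) hpos (fun w => ?_) fun w w' => ?_
  · rwa [Fintype.card_fin, Fintype.card_fin] at hpack
  · rw [← Matrix.smul_mul]
    refine ⟨(numDistinctRows_mul_le _ _).trans ?_,
      (Matrix.rank_mul_le_left _ _).trans (Matrix.rank_le_width _)⟩
    exact numDistinctRows_of_comp_le (fun l => c • fun j => (v l j : ℝ)) w
  · rw [hfrob, ← nsmul_eq_mul, ← Finset.card_univ]
    exact Finset.sum_le_card_nsmul _ _ _ fun i _ => hvnorm (w i)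
  · rw [← Matrix.sub_mul, hfrob, ← hammingDist_comp (fun _ => v) fun _ => hv]
    exact hammingDist_rows_le_frobSq_sub (N w) (N w')

theorem generalRate_pos {q r : ℕ} (hr : 1 ≤ r) (hq : 1 ≤ q) (p m b ζ : ℕ) :
    0 < generalRate p m q r b ζ := by
  rw [generalRate]
  positivity

theorem hasPacking_generalRate {q r b ζ : ℕ} (hr : 2 ≤ r) (hrq : r ≤ q) (hqp : q ≤ p)
    (hrm : r ≤ m) (hadm : Admissible q r b ζ) :
    HasPacking (signalClass p m q r) (generalRate p m q r b ζ / 384) := by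
  have hwide : HasPacking (signalClass p m q r) (((q - 1 : ℕ) : ℝ) * r / 64) :=
    (hasPacking_block (by lia) (by lia) (by lia) hrm).mono
      (fun C hC => ⟨hC.1.trans (by lia), hC.2.2⟩) le_rfl
  have htall : HasPacking (signalClass p m q r) (((r - 1 : ℕ) : ℝ) * m / 64) :=
    (hasPacking_block (by lia) (by lia) (by lia) le_rfl).mono
      (fun C hC => ⟨hC.1.trans (by lia), hC.2.1.trans (by lia)⟩) le_rfl
  have hclusters := hasPacking_clusters (p := p) (hr.trans hrq) (by lia) hrm hadm
  refine (hwide.max (htall.max hclusters)).mono subset_rfl ?_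
  set τ : ℝ := max _ (max _ _)
  have hqr : (q : ℝ) * r / 128 ≤ τ := by
    have : (q : ℝ) ≤ (q - 1 : ℕ) * 2 := by exact_mod_cast (by lia : q ≤ (q - 1) * 2)
    refine le_trans ?_ (le_max_left _ _)
    linarith [mul_le_mul_of_nonneg_right this (Nat.cast_nonneg r : (0 : ℝ) ≤ r)]
  have hmr : (m : ℝ) * r / 128 ≤ τ := by
    have : (r : ℝ) ≤ (r - 1 : ℕ) * 2 := by exact_mod_cast (by lia : r ≤ (r - 1) * 2)
    refine le_trans ?_ ((le_max_left _ _).trans (le_max_right _ _))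
    linarith [mul_le_mul_of_nonneg_right this (Nat.cast_nonneg m : (0 : ℝ) ≤ m)]
  have hlog : p * Real.log q / ((b : ℝ) ^ 2 * ζ) / 32 ≤ τ := by
    rw [div_div, mul_comm _ (32 : ℝ)]
    exact (le_max_right _ _).trans (le_max_right _ _)
  have hτ : 0 ≤ τ := le_trans (by positivity) hqr
  rw [generalRate]
  linarith

theorem hasPacking_rank_le {r : ℕ} (hr : 1 ≤ r) (hrk : r ≤ k) (hrm : r ≤ m) :
    HasPacking {C : Matrix (Fin k) (Fin m) ℝ | C.rank ≤ r} (((k : ℝ) + m) * r / 128) := by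
  have hwide : HasPacking {C : Matrix (Fin k) (Fin m) ℝ | C.rank ≤ r} (k * r / 64) :=
    (hasPacking_block (hr.trans hrk) hr le_rfl hrm).mono (fun C hC => hC.2.2) le_rfl
  have htall : HasPacking {C : Matrix (Fin k) (Fin m) ℝ | C.rank ≤ r} (r * m / 64) :=
    (hasPacking_block hr (hr.trans hrm) hrk le_rfl).mono (fun C hC => hC.2.1) le_rfl
  refine (hwide.max htall).mono subset_rfl ?_
  linarith [le_max_left (k * r / 64 : ℝ) (r * m / 64), le_max_right (k * r / 64 : ℝ) (r * m / 64)]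

end Packings
section Complexity

theorem div_pow_le_choose {n k : ℕ} (h : k ≤ n) : ((n : ℝ) / k) ^ k ≤ n.choose k := by
  induction k generalizing n with
  | zero => simp
  | succ k ih =>
    obtain ⟨n, rfl⟩ : ∃ n', n = n' + 1 := ⟨n - 1, by lia⟩
    have hkn : k ≤ n := Nat.le_of_succ_le_succ h
    have hbase : ((n + 1 : ℕ) : ℝ) / (k + 1 : ℕ) ≤ n / k ∨ k = 0 := by
      refine k.eq_zero_or_pos.symm.imp_left fun hk => ?_
      rw [div_le_div_iff₀ (by positivity) (by positivity)]
      exact_mod_cast (by lia : (n + 1) * k ≤ n * (k + 1))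
    calc (((n + 1 : ℕ) : ℝ) / (k + 1 : ℕ)) ^ (k + 1)
        = (((n + 1 : ℕ) : ℝ) / (k + 1 : ℕ)) ^ k * (((n + 1 : ℕ) : ℝ) / (k + 1 : ℕ)) := pow_succ _ _
      _ ≤ (n / k) ^ k * (((n + 1 : ℕ) : ℝ) / (k + 1 : ℕ)) := by
          rcases hbase with hbase | rfl
          · gcongr
          · simp
      _ ≤ n.choose k * (((n + 1 : ℕ) : ℝ) / (k + 1 : ℕ)) := by gcongr; exact ih hkn
      _ = (n + 1).choose (k + 1) := by
          rw [mul_div_assoc', div_eq_iff (by positivity), mul_comm]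
          exact_mod_cast Nat.add_one_mul_choose_eq n k

theorem admissible_of_le_pow {q r b ζ : ℕ} (hb : 2 ≤ b) (hζ : 1 ≤ ζ) (hζr : ζ ≤ r)
    (hq : (q : ℝ) ≤ (r / ζ * (b - 1 : ℕ)) ^ ζ) : Admissible q r b ζ := by
  refine ⟨hb, hζ, hζr, ?_⟩
  have hterm : (q : ℝ) ≤ r.choose ζ * (b - 1 : ℕ) ^ ζ := by
    refine hq.trans ?_
    rw [mul_pow]
    gcongr
    exact div_pow_le_choose hζr
  calc q ≤ r.choose ζ * (b - 1) ^ ζ := by exact_mod_cast hterm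
    _ ≤ _ := Finset.single_le_sum (f := fun i => r.choose i * (b - 1) ^ i)
        (fun _ _ => Nat.zero_le _) (Finset.self_mem_range_succ ζ)

theorem exists_exp_le_pow {r : ℕ} {L : ℝ} (hL : 1 ≤ L) (hLr : L ≤ r) (hrL : Real.log r ≤ L) :
    ∃ ζ : ℕ, 1 ≤ ζ ∧ ζ ≤ r ∧ Real.exp L ≤ (r / ζ * 9) ^ ζ ∧
      ζ * (Real.log (Real.exp 1 * r) - Real.log L) ≤ 3 * L := by
  have hL₀ : 0 < L := by linarith
  have hr₀ : (0 : ℝ) < r := hL₀.trans_le hLr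
  set l := Real.log (Real.exp 1 * r) - Real.log L with hl
  have hl_eq : l = 1 + Real.log r - Real.log L := by
    rw [hl, Real.log_mul (Real.exp_pos 1).ne' hr₀.ne', Real.log_exp]
  have hl₁ : 1 ≤ l := by linarith [Real.log_le_log hL₀ hLr]
  have hl₂ : l ≤ 2 * L := by linarith [Real.log_nonneg hL]
  have hl₀ : 0 < l := by linarith
  have hexp : Real.exp l = Real.exp 1 * r / L := by
    rw [hl, Real.exp_sub, Real.exp_log (by positivity), Real.exp_log hL₀]
  have hratio : L / l ≤ L := div_le_self hL₀.le hl₁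
  -- `⌈L / l⌉ ≤ 3 L / l` because `L / l ≥ 1 / 2`
  have hceil : (⌈L / l⌉₊ : ℝ) * l ≤ 3 * L := by
    rw [← le_div_iff₀ hl₀, mul_div_assoc]
    have : 1 / 2 ≤ L / l := (le_div_iff₀ hl₀).2 (by linarith)
    linarith [Nat.ceil_lt_add_one (div_nonneg hL₀.le hl₀.le)]
  have hζ : 0 < ⌈L / l⌉₊ := Nat.ceil_pos.2 (by positivity)
  refine ⟨⌈L / l⌉₊, hζ, Nat.ceil_le.2 (hratio.trans hLr), ?_, hceil⟩
  calc Real.exp L ≤ Real.exp (⌈L / l⌉₊ * l) :=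
        Real.exp_le_exp.2 ((div_le_iff₀ hl₀).1 (Nat.le_ceil _))
    _ = Real.exp l ^ ⌈L / l⌉₊ := Real.exp_nat_mul l _
    _ ≤ (r / ⌈L / l⌉₊ * 9) ^ ⌈L / l⌉₊ := by
        gcongr
        rw [hexp, div_mul_eq_mul_div, div_le_div_iff₀ hL₀ (by positivity)]
        calc Real.exp 1 * r * ⌈L / l⌉₊ ≤ 3 * r * (3 * L) := by
              gcongr
              · linarith [Real.exp_one_lt_d9]
              · nlinarith
          _ = r * 9 * L := by ring

theorem complexityP_pos {q r : ℕ} (hr : 1 ≤ r) (hq : 2 ≤ q) (hqr : (q : ℝ) ≤ Real.exp r)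
    (p m : ℕ) : 0 < complexityP p m q r := by
  have hq₁ : (1 : ℝ) < q := Nat.one_lt_cast.2 hq
  have hlog : Real.log (Real.log q) ≤ Real.log (Real.exp 1 * r) := by
    refine Real.log_le_log (Real.log_pos hq₁) ?_
    calc Real.log q ≤ r := (Real.log_le_iff_le_exp (by positivity)).2 hqr
      _ ≤ Real.exp 1 * r := le_mul_of_one_le_left (by positivity) (Real.one_le_exp zero_le_one)
  have := sub_nonneg.2 hlog
  rw [complexityP]
  positivity

theorem exists_admissible_complexityP_le {q r : ℕ} (hrq : r ≤ q) (hq : 3 ≤ q)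
    (hqr : (q : ℝ) ≤ Real.exp r) (p m : ℕ) :
    ∃ b ζ, Admissible q r b ζ ∧ complexityP p m q r ≤ 300 * generalRate p m q r b ζ := by
  have hq₀ : (0 : ℝ) < q := by positivity
  have hlog₁ : 1 ≤ Real.log q := by
    rw [Real.le_log_iff_exp_le hq₀]
    have : (3 : ℝ) ≤ q := Nat.ofNat_le_cast.2 hq
    linarith [Real.exp_one_lt_d9]
  have hlogr : Real.log q ≤ r := (Real.log_le_iff_le_exp hq₀).2 hqr
  have hr₀ : (0 : ℝ) < r := by linarith
  obtain ⟨ζ, hζ, hζr, hexp, hle⟩ := exists_exp_le_pow hlog₁ hlogr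
    (Real.log_le_log hr₀ (Nat.cast_le.2 hrq))
  rw [Real.exp_log hq₀] at hexp
  refine ⟨10, ζ, admissible_of_le_pow (by norm_num) hζ hζr (by exact_mod_cast hexp), ?_⟩
  have hterm : Real.log (Real.exp 1 * r) - Real.log (Real.log q) ≤
      300 * (Real.log q / (((10 : ℕ) : ℝ) ^ 2 * ζ)) := by
    rw [← mul_div_assoc, le_div_iff₀ (by positivity)]
    push_cast
    linarith
  have hblock : (0 : ℝ) ≤ ((q : ℝ) + m) * r := by positivity
  rw [complexityP, generalRate, mul_div_assoc]
  linarith [mul_le_mul_of_nonneg_left hterm (Nat.cast_nonneg p : (0 : ℝ) ≤ p)]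

theorem hasPacking_complexityP {q r : ℕ} (hr : 2 ≤ r) (hrq : r ≤ q) (hqp : q ≤ p) (hrm : r ≤ m)
    (hq : 3 ≤ q) (hqr : (q : ℝ) ≤ Real.exp r) :
    HasPacking (signalClass p m q r) (complexityP p m q r / (300 * 384)) := by
  obtain ⟨b, ζ, hadm, hle⟩ := exists_admissible_complexityP_le hrq hq hqr p m
  exact (hasPacking_generalRate hr hrq hqp hrm hadm).mono subset_rfl (by linarith)

end Complexity
section MinimaxBounds

variable {q r k l : ℕ} {σ : ℝ} {ν : Measure (Matrix (Fin n) (Fin m) ℝ)}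
  {X : Matrix (Fin n) (Fin p) ℝ} {J : ℝ → ℝ}

theorem ofReal_div_le_lintegral_of_le_measureReal {Ω : Type*} [MeasurableSpace Ω] {μ : Measure Ω}
    [IsFiniteMeasure μ] {f : Ω → ℝ} (hf : Measurable f) (hf₀ : ∀ ω, 0 ≤ f ω)
    (hJ : MonotoneOn J (Set.Ici 0)) {s N : ℝ} (hs : 0 ≤ s) (hN : 0 ≤ N)
    (hμ : 1 / N ≤ μ.real {ω | s ≤ f ω}) :
    ENNReal.ofReal (J s / N) ≤ ∫⁻ ω, ENNReal.ofReal (J (f ω)) ∂μ := by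
  have hmeas : MeasurableSet {ω | s ≤ f ω} := measurableSet_le measurable_const hf
  calc ENNReal.ofReal (J s / N) = ENNReal.ofReal (J s) * ENNReal.ofReal (1 / N) := by
        rw [← ENNReal.ofReal_mul' (by positivity), mul_one_div]
    _ ≤ ENNReal.ofReal (J s) * μ {ω | s ≤ f ω} := by
        gcongr
        rw [← ofReal_measureReal]
        exact ENNReal.ofReal_le_ofReal hμ
    _ = ∫⁻ _ in {ω | s ≤ f ω}, ENNReal.ofReal (J s) ∂μ := (setLIntegral_const _ _).symm
    _ ≤ ∫⁻ ω in {ω | s ≤ f ω}, ENNReal.ofReal (J (f ω)) ∂μ :=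
        setLIntegral_mono' hmeas fun ω hω => ENNReal.ofReal_le_ofReal (hJ hs (hf₀ ω) hω)
    _ ≤ ∫⁻ ω, ENNReal.ofReal (J (f ω)) ∂μ := setLIntegral_le_lintegral _ _

theorem klDiv_glmLaw_zero_le [NeZero ν] (hσ : 0 < σ) (hreg : IsOpen (naturalSpace ν σ))
    (h0 : 0 ∈ naturalSpace ν σ) {Z : Matrix (Fin n) (Fin k) ℝ} {S : Set (Matrix (Fin k) (Fin m) ℝ)}
    {κ L : ℝ} (hκ : 0 < κ) (hcurv : CurvatureBound σ ν Z S κ) {C : Matrix (Fin k) (Fin m) ℝ}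
    (hC : C ∈ S) (hZC : Z * C ∈ naturalSpace ν σ) (hnorm : frobSq C ≤ σ ^ 2 / (4 * κ) * L) :
    klDiv (glmLaw ν σ (Z * C)) (glmLaw ν σ 0) ≤ ENNReal.ofReal (L / 8) := by
  rw [klDiv_glmLaw hσ.ne' hreg hZC h0 0]
  refine ENNReal.ofReal_le_ofReal ?_
  have h := hcurv C hC 0
  rw [D₂, zero_sub, frobSq_neg, ← le_div_iff₀ (by positivity)] at h
  calc bregman (glmLoss ν σ 0) 0 (Z * C) ≤ κ * (frobSq C / 2) / σ ^ 2 := h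
    _ ≤ κ * (σ ^ 2 / (4 * κ) * L / 2) / σ ^ 2 := by gcongr
    _ = L / 8 := by field_simp; ring

/- The null law `P_0` plays the role of a common reference, and the scale `σ² / (4 κ)` makes every
hypothesis of the packing within `(log M) / 8` of it. -/
theorem le_minimaxRisk_of_hasPacking (hmod : IsModel q r σ ν X) {W : Matrix (Fin p) (Fin k) ℝ}
    {S : Set (Matrix (Fin k) (Fin m) ℝ)} (hWS : ∀ C ∈ S, W * C ∈ signalClass p m q r)
    {κ τ : ℝ} (hκ : 0 < κ) (hcurv : CurvatureBound σ ν (X * W) S κ)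
    (hpack : HasPacking S τ) (hτ : 0 ≤ τ) (A : Matrix (Fin l) (Fin p) ℝ) {μ : ℝ} (hμ : 0 ≤ μ)
    (hsep : ∀ C ∈ S, ∀ C' ∈ S, μ * frobSq (C - C') ≤ frobSq (A * (W * C) - A * (W * C')))
    (hJ : MonotoneOn J (Set.Ici 0)) :
    ENNReal.ofReal (J (μ * (σ ^ 2 * τ) / (16 * κ)) / 8) ≤
      minimaxRisk q r σ ν X fun B B' => J (frobSq (A * B - A * B')) := by
  have hσ := hmod.σ_pos
  have : NeZero ν := ⟨hmod.ν_ne_zero⟩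
  have h0 : 0 ∈ naturalSpace ν σ := by
    simpa using hmod.mem_naturalSpace 0
      (zero_mem_signalClass (by linarith [hmod.two_le_r, hmod.r_le_q]))
  obtain ⟨ι, _, C, hι, hC, hnorm, hdist⟩ := hpack (σ ^ 2 / (4 * κ)) (by positivity)
  have hmem (i : ι) : X * (W * C i) ∈ naturalSpace ν σ := hmod.mem_naturalSpace _ (hWS _ (hC i))
  have (i : ι) := isProbabilityMeasure_glmLaw hσ.ne' (hmem i)
  have := isProbabilityMeasure_glmLaw hσ.ne' h0
  have hkl (i : ι) : klDiv (glmLaw ν σ (X * (W * C i))) (glmLaw ν σ 0) ≤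
      ENNReal.ofReal (Real.log (Fintype.card ι) / 8) := by
    rw [← Matrix.mul_assoc]
    exact klDiv_glmLaw_zero_le hσ hmod.regular h0 hκ hcurv (hC i)
      (by rw [Matrix.mul_assoc]; exact hmem i) (hnorm i)
  refine le_iInf₂ fun Bhat hBhat => ?_
  have hloss (i : ι) : Measurable fun Y => frobSq (A * (W * C i) - A * Bhat Y) :=
    measurable_frobSq.comp ((measurable_const_sub_mul _ A).comp hBhat)
  obtain ⟨i, hi⟩ := exists_measureReal_ge_of_klDiv_le hι hkl hloss
    (s := μ * (σ ^ 2 * τ) / (16 * κ)) fun i j hij Y => by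
      have h₁ := mul_le_mul_of_nonneg_left (hdist i j hij) hμ
      have h₂ := hsep _ (hC i) _ (hC j)
      have h₃ := frobSq_sub_le (A * (W * C i)) (A * (W * C j)) (A * Bhat Y)
      have h₄ : μ * (σ ^ 2 / (4 * κ) * τ) = 4 * (μ * (σ ^ 2 * τ) / (16 * κ)) := by
        field_simp; ring
      linarith
  exact le_iSup₂_of_le (W * C i) (hWS _ (hC i))
    (ofReal_div_le_lintegral_of_le_measureReal (hloss i)
      (fun Y => Finset.sum_nonneg fun _ _ => Finset.sum_nonneg fun _ _ => sq_nonneg _)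
      hJ (by positivity) (by norm_num) hi)

theorem le_minimaxRisk_prediction (hmod : IsModel q r σ ν X) {W : Matrix (Fin p) (Fin k) ℝ}
    {S : Set (Matrix (Fin k) (Fin m) ℝ)} (hWS : ∀ C ∈ S, W * C ∈ signalClass p m q r)
    {κlo κhi τ : ℝ} (hcond : CondNumberBound σ ν (X * W) S κlo κhi) (hpack : HasPacking S τ)
    (hτ : 0 ≤ τ) (hJ : MonotoneOn J (Set.Ici 0)) :
    ENNReal.ofReal (J (κlo * (σ ^ 2 * τ) / (16 * κhi)) / 8) ≤
      minimaxRisk q r σ ν X fun B B' => J (frobSq (X * B - X * B')) := by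
  refine le_minimaxRisk_of_hasPacking hmod hWS hcond.hi_pos hcond.upper hpack hτ X
    hcond.lo_pos.le (fun C hC C' hC' => ?_) hJ
  have h := hcond.lower C hC C' hC'
  simp only [D₂, Matrix.mul_assoc] at h
  linarith

theorem IsLossFunction.exists_pos {I : ℝ → ℝ} (hI : IsLossFunction I) :
    ∃ t, 0 < t ∧ 0 < I t := by
  obtain ⟨t, ht, hIt⟩ := hI.nontrivial
  refine ⟨t, ht.lt_of_ne fun h => hIt (h ▸ hI.zero), lt_of_le_of_ne ?_ hIt.symm⟩
  exact hI.zero.symm.le.trans (hI.mono Set.self_mem_Ici ht ht)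

theorem IsLossFunction.monotoneOn_div {I : ℝ → ℝ} (hI : IsLossFunction I) {ρ : ℝ} (hρ : 0 ≤ ρ) :
    MonotoneOn (fun x => I (x / ρ)) (Set.Ici 0) :=
  hI.mono.comp (fun _ _ _ _ h => div_le_div_of_nonneg_right h hρ) fun _ hx => div_nonneg hx hρ

theorem IsModel.parameter_bounds (hmod : IsModel q r σ ν X) : 2 ≤ r ∧ r ≤ q ∧ q ≤ p ∧ r ≤ m :=
  ⟨hmod.two_le_r, hmod.r_le_q, hmod.q_le_p, hmod.r_le_m⟩

theorem le_minimaxRisk_estimation_loss (hmod : IsModel q r σ ν X) {κ R K t : ℝ} (hκ : 0 < κ)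
    (hcurv : CurvatureBound σ ν X (signalClass p m q r) κ)
    (hpack : HasPacking (signalClass p m q r) (R / K)) (hR : 0 < R) (hK : 0 < K)
    {I : ℝ → ℝ} (hI : IsLossFunction I) (ht : 0 < t) :
    ENNReal.ofReal (I t / 8) ≤ minimaxRisk q r σ ν X fun B B' =>
      I (frobSq (B - B') / (1 / (16 * K * t) * σ ^ 2 * R / κ)) := by
  have hσ := hmod.σ_pos
  have h := le_minimaxRisk_of_hasPacking hmod (W := 1) (A := (1 : Matrix (Fin p) (Fin p) ℝ))
    (fun C hC => by rwa [Matrix.one_mul]) hκ (by rwa [Matrix.mul_one]) hpack (by positivity)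
    zero_le_one (fun C _ C' _ => by simp only [Matrix.one_mul, one_mul, le_refl])
    (hI.monotoneOn_div (ρ := 1 / (16 * K * t) * σ ^ 2 * R / κ) (by positivity))
  simp only [Matrix.one_mul, one_mul] at h
  have hscale : σ ^ 2 * (R / K) / (16 * κ) / (1 / (16 * K * t) * σ ^ 2 * R / κ) = t := by
    field_simp
  rwa [hscale] at h

theorem le_minimaxRisk_prediction_loss (hmod : IsModel q r σ ν X) {W : Matrix (Fin p) (Fin k) ℝ}
    {S : Set (Matrix (Fin k) (Fin m) ℝ)} (hWS : ∀ C ∈ S, W * C ∈ signalClass p m q r)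
    {κlo κhi R K t : ℝ} (hcond : CondNumberBound σ ν (X * W) S κlo κhi)
    (hpack : HasPacking S (R / K)) (hR : 0 < R) (hK : 0 < K)
    {I : ℝ → ℝ} (hI : IsLossFunction I) (ht : 0 < t) :
    ENNReal.ofReal (I t / 8) ≤ minimaxRisk q r σ ν X fun B B' =>
      I (frobSq (X * B - X * B') / (1 / (16 * K * t) * (κlo / κhi) * σ ^ 2 * R)) := by
  have hσ := hmod.σ_pos
  have hlo := hcond.lo_pos
  have hhi := hcond.hi_pos
  have h := le_minimaxRisk_prediction hmod hWS hcond hpack (by positivity)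
    (hI.monotoneOn_div (ρ := 1 / (16 * K * t) * (κlo / κhi) * σ ^ 2 * R) (by positivity))
  have hscale : κlo * (σ ^ 2 * (R / K)) / (16 * κhi) /
      (1 / (16 * K * t) * (κlo / κhi) * σ ^ 2 * R) = t := by
    field_simp
  simpa only [hscale] using h

theorem le_minimaxRisk_prediction_frobSq (hmod : IsModel q r σ ν X)
    {W : Matrix (Fin p) (Fin k) ℝ} {S : Set (Matrix (Fin k) (Fin m) ℝ)}
    (hWS : ∀ C ∈ S, W * C ∈ signalClass p m q r) {κlo κhi R K : ℝ}
    (hcond : CondNumberBound σ ν (X * W) S κlo κhi) (hpack : HasPacking S (R / K))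
    (hR : 0 < R) (hK : 0 < K) :
    ENNReal.ofReal (1 / (128 * K) * (κlo / κhi) * σ ^ 2 * R) ≤
      minimaxRisk q r σ ν X fun B B' => frobSq (X * B - X * B') := by
  have h := le_minimaxRisk_prediction (J := fun x => x) hmod hWS hcond hpack (by positivity)
    monotoneOn_id
  have hhi := hcond.hi_pos
  have hscale : κlo * (σ ^ 2 * (R / K)) / (16 * κhi) / 8 =
      1 / (128 * K) * (κlo / κhi) * σ ^ 2 * R := by
    field_simp
    ring
  rwa [hscale] at h

theorem IsCompactSVD.exists_mul_eq {U : Matrix (Fin n) (Fin X.rank) ℝ} {d : Fin X.rank → ℝ}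
    {V : Matrix (Fin p) (Fin X.rank) ℝ} (hsvd : IsCompactSVD X U d V) (hq : X.rank < q) :
    ∃ W : Matrix (Fin p) (Fin X.rank) ℝ, X * W = U * Matrix.diagonal d ∧
      ∀ C : Matrix (Fin X.rank) (Fin m) ℝ, C.rank ≤ r → W * C ∈ signalClass p m q r := by
  have hrank : Vᵀ.rank = X.rank := by
    refine le_antisymm (Matrix.rank_le_height Vᵀ) ?_
    have h := Matrix.rank_mul_le_left Vᵀ V
    rwa [hsvd.V_orth, Matrix.rank_one, Fintype.card_fin] at h
  obtain ⟨f, R, hR⟩ := exists_mul_rowEmbedding_mul_eq_one hrank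
  refine ⟨rowEmbedding f * R, ?_, fun C hC => ⟨?_, (Matrix.rank_mul_le_right _ _).trans hC⟩⟩
  · calc X * (rowEmbedding f * R) = U * Matrix.diagonal d * Vᵀ * (rowEmbedding f * R) :=
          congrArg (· * (rowEmbedding f * R)) hsvd.eq
      _ = U * Matrix.diagonal d := by rw [Matrix.mul_assoc _ Vᵀ, hR, Matrix.mul_one]
  · rw [Matrix.mul_assoc]
    exact (numDistinctRows_rowEmbedding_mul_le f _).trans hq

theorem le_minimaxRisk_prediction_loss_of_rank_lt (hmod : IsModel q r σ ν X) (hq : X.rank < q)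
    (hr : r ≤ X.rank) {U : Matrix (Fin n) (Fin X.rank) ℝ} {d : Fin X.rank → ℝ}
    {V : Matrix (Fin p) (Fin X.rank) ℝ} (hsvd : IsCompactSVD X U d V) {κlo κhi K t : ℝ}
    (hcond : CondNumberBound σ ν (U * Matrix.diagonal d)
      {C : Matrix (Fin X.rank) (Fin m) ℝ | C.rank ≤ r} κlo κhi)
    (hK : 128 ≤ K) {I : ℝ → ℝ} (hI : IsLossFunction I) (ht : 0 < t) :
    ENNReal.ofReal (I t / 8) ≤ minimaxRisk q r σ ν X fun B B' =>
      I (frobSq (X * B - X * B') /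
        (1 / (16 * K * t) * (κlo / κhi) * σ ^ 2 * (((X.rank : ℝ) + m) * r))) := by
  obtain ⟨hr₂, -, -, hrm⟩ := hmod.parameter_bounds
  obtain ⟨W, hXW, hWS⟩ := hsvd.exists_mul_eq hq
  have hrate : 0 < ((X.rank : ℝ) + m) * r := by
    exact_mod_cast Nat.mul_pos (by lia : 0 < X.rank + m) (by lia : 0 < r)
  refine le_minimaxRisk_prediction_loss hmod hWS (hXW ▸ hcond)
    ((hasPacking_rank_le (by lia) hr hrm).mono subset_rfl ?_) hrate (by linarith) hI ht
  gcongr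

end MinimaxBounds

end CRL

open CRL in
theorem theorem1 :
    (∀ I : ℝ → ℝ, IsLossFunction I →
      ∃ c : ℝ, 0 < c ∧ ∃ c' : ℝ, 0 < c' ∧
      ∀ (n p m q r : ℕ) (σ : ℝ) (ν : Measure (Matrix (Fin n) (Fin m) ℝ))
        (X : Matrix (Fin n) (Fin p) ℝ), IsModel q r σ ν X →
        -- (a) estimation error
        (∀ κ : ℝ, 0 < κ → CurvatureBound σ ν X (signalClass p m q r) κ →
          (∀ b ζ : ℕ, Admissible q r b ζ →
            ENNReal.ofReal c' ≤ minimaxRisk q r σ ν X fun B B' =>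
              I (frobSq (B - B') / (c * σ ^ 2 * generalRate p m q r b ζ / κ))) ∧
          (8 ≤ q → (q : ℝ) ≤ Real.exp r →
            ENNReal.ofReal c' ≤ minimaxRisk q r σ ν X fun B B' =>
              I (frobSq (B - B') / (c * σ ^ 2 * complexityP p m q r / κ)))) ∧
        -- (b) prediction error, `q ≤ rank X`
        (q ≤ X.rank → ∀ κlo κhi : ℝ, CondNumberBound σ ν X (signalClass p m q r) κlo κhi →
          ∀ b ζ : ℕ, Admissible q r b ζ →
            ENNReal.ofReal c' ≤ minimaxRisk q r σ ν X fun B B' =>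
              I (frobSq (X * B - X * B') /
                (c * (κlo / κhi) * σ ^ 2 * generalRate p m q r b ζ))) ∧
        -- (b) prediction error, `q > rank X`
        (X.rank < q → r ≤ X.rank →
          ∀ (U : Matrix (Fin n) (Fin X.rank) ℝ) (d : Fin X.rank → ℝ)
            (V : Matrix (Fin p) (Fin X.rank) ℝ), IsCompactSVD X U d V →
          ∀ κlo κhi : ℝ,
            CondNumberBound σ ν (U * Matrix.diagonal d)
              {C : Matrix (Fin X.rank) (Fin m) ℝ | C.rank ≤ r} κlo κhi →
            ENNReal.ofReal c' ≤ minimaxRisk q r σ ν X fun B B' =>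
              I (frobSq (X * B - X * B') /
                (c * (κlo / κhi) * σ ^ 2 * (((X.rank : ℝ) + m) * r))))) ∧
    -- (b) mean squared prediction error, `8 ≤ q ≤ e^r` and `q ≤ rank X`
    (∃ c : ℝ, 0 < c ∧
      ∀ (n p m q r : ℕ) (σ : ℝ) (ν : Measure (Matrix (Fin n) (Fin m) ℝ))
        (X : Matrix (Fin n) (Fin p) ℝ), IsModel q r σ ν X →
        8 ≤ q → (q : ℝ) ≤ Real.exp r → q ≤ X.rank →
        ∀ κlo κhi : ℝ, CondNumberBound σ ν X (signalClass p m q r) κlo κhi →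
          ENNReal.ofReal (c * (κlo / κhi) * σ ^ 2 * complexityP p m q r) ≤
            minimaxRisk q r σ ν X fun B B' => frobSq (X * B - X * B')) := by
  constructor
  · intro I hI
    obtain ⟨t, ht, hIt⟩ := hI.exists_pos
    refine ⟨1 / (16 * (300 * 384) * t), by positivity, I t / 8, by positivity,
      fun n p m q r σ ν X hmod => ?_⟩
    obtain ⟨hr, hrq, hqp, hrm⟩ := hmod.parameter_bounds
    have hpos (b ζ : ℕ) : 0 < generalRate p m q r b ζ := generalRate_pos (by lia) (by lia) p m b ζ
    have hpack {b ζ : ℕ} (hadm : Admissible q r b ζ) :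
        HasPacking (signalClass p m q r) (generalRate p m q r b ζ / (300 * 384)) :=
      (hasPacking_generalRate hr hrq hqp hrm hadm).mono subset_rfl (by linarith [hpos b ζ])
    refine ⟨fun κ hκ hcurv => ⟨fun b ζ hadm => ?_, fun hq hqr => ?_⟩,
      fun _ κlo κhi hcond b ζ hadm => ?_, fun hXq hrX U d V hsvd κlo κhi hcond => ?_⟩
    · exact le_minimaxRisk_estimation_loss hmod hκ hcurv (hpack hadm) (hpos b ζ) (by norm_num) hI
        ht
    · exact le_minimaxRisk_estimation_loss hmod hκ hcurv
        (hasPacking_complexityP hr hrq hqp hrm (by lia) hqr)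
        (complexityP_pos (by lia) (by lia) hqr p m) (by norm_num) hI ht
    · exact le_minimaxRisk_prediction_loss hmod (W := 1) (by simp) (by rwa [Matrix.mul_one])
        (hpack hadm) (hpos b ζ) (by norm_num) hI ht
    · exact le_minimaxRisk_prediction_loss_of_rank_lt hmod hXq hrX hsvd hcond (by norm_num) hI ht
  · refine ⟨1 / (128 * (300 * 384)), by norm_num,
      fun n p m q r σ ν X hmod hq hqr _ κlo κhi hcond => ?_⟩
    obtain ⟨hr, hrq, hqp, hrm⟩ := hmod.parameter_bounds
    exact le_minimaxRisk_prediction_frobSq hmod (W := 1) (by simp) (by rwa [Matrix.mul_one])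
      (hasPacking_complexityP hr hrq hqp hrm (by lia) hqr)
      (complexityP_pos (by lia) (by lia) hqr p m) (by norm_num)
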